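/- Let $n,d\ge 1$ and $q\ge 0$ be integers, let $P\in\mathbb R[X_1,\dots,X_n]$ be homogeneous of degree $d$ and elliptic, i.e. $P(x)>0$ for all $x\in[0,\infty)^n\setminus\{0\}$, and let $Q\in\mathbb R[X_1,\dots,X_n]$ be homogeneous of degree $q$. Write $\mathbb N=\{1,2,\dots\}$ and $\mathbb N_0=\mathbb N\cup\{0\}$. For a tuple $a$ of non-negative integers let $|a|$ be the sum and $a!$ the product of the factorials of its entries, and for $\gamma\in\mathbb N_0^n$ put $\partial^{\gamma}=\partial_1^{\gamma_1}\cdots\partial_n^{\gamma_n}$. The Mahler series $$Z(P,Q;s)=\sum_{m\in\mathbb N^n}Q(m)\,P(m)^{-s}$$ converges absolutely for $\Re(s)>(n+q)/d$ and has a meromorphic continuation to $\mathbb C$. For every $N\in\mathbb N_0$ this continuation is regular at $s=-N$, and $$Z(P,Q;-N)=\sum_{\substack{\beta\in\mathbb N_0^n\\ |\beta|\le q}}\ \sum_{\alpha\in I_N(\beta)}\ \sum_{u\in V(\alpha)}\frac{(-1)^{|\alpha|-N}\,(|\alpha|-1-N)!\,N!}{d\;\alpha!\,\beta!}\left(\sum_{i=1}^n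 K_i(P;Q;N;\alpha,u,\beta)\right)\prod_{i=1}^n\widetilde B_{g_i(u)+\beta_i},$$ where the notation is as follows. * $I_N(\beta)$ is the set of $\alpha=(\alpha_1,\dots,\alpha_d)\in\mathbb N_0^d$ with $\sum_{k=1}^d k\alpha_k+|\beta|=dN+q+n$ (each such $\alpha$ satisfies $|\alpha|\ge N+1$). * $\Delta_k^n=\{\gamma\in\mathbb N_0^n:|\gamma|=k\}$, and $V(\alpha)$ is the set of families $u=(u_1,\dots,u_d)$, $u_k=(u_{k,\gamma})_{\gamma\in\Delta_k^n}$, of non-negative integers with $|u_k|=\alpha_k$ for $1\le k\le d$. * $g_i(u)=\sum_{k=1}^d\sum_{\gamma\in\Delta_k^n}u_{k,\gamma}\,\gamma_i$. * For $1\le i\le n$, $\hat y(i)=(y_1,\dots,y_{i-1},1,y_{i+1},\dots,y_n)$, $$P^i_{\alpha,u}(\hat y(i))=\frac{\alpha!}{\prod_{k=1}^d u_k!}\prod_{k=1}^d\prod_{\gamma\in\Delta_k^n}\left(\frac{\partial^{\gamma}P(\hat y(i))}{\gamma!}\right)^{u_{k,\gamma}},$$ $$K_i(P;Q;N;\alpha,u,\beta)=\int_{[0,1]^{n-1}}P(\hat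 y(i))^{N-|\alpha|}\,P^i_{\alpha,u}(\hat y(i))\,(\partial^{\beta}Q)(\hat y(i))\prod_{k\ne i}dy_k .$$ * $\widetilde B_k=B_k$ for $k\ne1$ and $\widetilde B_1=-B_1=\tfrac12$, where $\frac{X}{e^X-1}=\sum_{k\ge0}\frac{B_k}{k!}X^k$. -/

import Mathlib

namespace MahlerSeries

noncomputable section

/-- A real polynomial in `n` variables is elliptic if its homogeneous part of highest degree is
positive at every nonzero point of `[0, ∞)^n`. -/
def IsElliptic {n : ℕ} (P : MvPolynomial (Fin n) ℝ) : Prop :=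
  ∀ x : Fin n → ℝ, (∀ i, 0 ≤ x i) → x ≠ 0 →
    0 < MvPolynomial.eval x (MvPolynomial.homogeneousComponent P.totalDegree P)

/-- The term `Q(m) / P(m)^s` of the Mahler series; `m` runs over the `n`-tuples of positive
integers. -/
def term {n : ℕ} (P Q : MvPolynomial (Fin n) ℝ) (s : ℂ) (m : Fin n → ℕ+) : ℂ :=
  ((MvPolynomial.eval (fun i => ((m i : ℕ) : ℝ)) Q : ℝ) : ℂ) /
    ((MvPolynomial.eval (fun i => ((m i : ℕ) : ℝ)) P : ℝ) : ℂ) ^ s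

/-- `Z` is the meromorphic continuation to `ℂ` of the Mahler series
`∑_{m ∈ ℕ^n} Q(m) P(m)^{-s}`: the series converges (absolutely) to `Z s` in the half plane
`Re s > (n + q) / d`, and `Z` is meromorphic on `ℂ`. The normal form only fixes the values of `Z`
at isolated points: `Z` has its limit value at every regular point, and the value `0` at poles. -/
structure IsContinuation {n : ℕ} (P Q : MvPolynomial (Fin n) ℝ) (d q : ℕ) (Z : ℂ → ℂ) :
    Prop where
  hasSum : ∀ s : ℂ, ((n : ℝ) + q) / d < s.re → HasSum (term P Q s) (Z s)
  meromorphic : MeromorphicNFOn Z Set.univ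

/-- The multi-indices `β ∈ ℕ₀^n` with `|β| ≤ q`. -/
def betas (n q : ℕ) : Finset (Fin n → ℕ) :=
  (Finset.Iic (fun _ : Fin n => q)).filter fun β => ∑ i, β i ≤ q

theorem mem_betas {n q : ℕ} {β : Fin n → ℕ} : β ∈ betas n q ↔ ∑ i, β i ≤ q := by
  simp only [betas, Finset.mem_filter, Finset.mem_Iic, and_iff_right_iff_imp]
  intro h i
  exact (Finset.single_le_sum (fun j _ => Nat.zero_le (β j)) (Finset.mem_univ i)).trans h

/-- The set `I_N(β)` of all `α = (α_1, …, α_d) ∈ ℕ₀^d` with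
`∑_k k α_k + |β| = d N + q + n`; the index `k : Fin d` stands for `k + 1`. -/
def indexSet {n : ℕ} (d q N : ℕ) (β : Fin n → ℕ) : Finset (Fin d → ℕ) :=
  (Finset.Iic (fun _ : Fin d => d * N + q + n)).filter fun α =>
    ∑ k : Fin d, ((k : ℕ) + 1) * α k + ∑ i, β i = d * N + q + n

theorem mem_indexSet {n d q N : ℕ} {β : Fin n → ℕ} {α : Fin d → ℕ} :
    α ∈ indexSet d q N β ↔
      ∑ k : Fin d, ((k : ℕ) + 1) * α k + ∑ i, β i = d * N + q + n := by
  simp only [indexSet, Finset.mem_filter, Finset.mem_Iic, and_iff_right_iff_imp]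
  intro h k
  have h1 : ((k : ℕ) + 1) * α k ≤ ∑ k : Fin d, ((k : ℕ) + 1) * α k :=
    Finset.single_le_sum (f := fun k : Fin d => ((k : ℕ) + 1) * α k)
      (fun j _ => Nat.zero_le _) (Finset.mem_univ k)
  have h2 : α k ≤ ((k : ℕ) + 1) * α k := Nat.le_mul_of_pos_left _ (Nat.succ_pos _)
  show α k ≤ d * N + q + n
  omega

/-- `Δ_k^n`: the multi-indices `γ ∈ ℕ₀^n` with `|γ| = k`. -/
def Delta (n k : ℕ) : Finset (Fin n → ℕ) :=
  Finset.piAntidiag Finset.univ k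

theorem mem_Delta {n k : ℕ} {γ : Fin n → ℕ} : γ ∈ Delta n k ↔ ∑ i, γ i = k := by
  simp [Delta]

/-- The families `u = (u_1, …, u_d)` with `u_k = (u_{k,γ})_{γ ∈ Δ_k^n}` of non-negative integers;
the index `k : Fin d` stands for `k + 1`. -/
abbrev Family (n d : ℕ) : Type :=
  (k : Fin d) → {γ : Fin n → ℕ // γ ∈ Delta n ((k : ℕ) + 1)} → ℕ

/-- The set `V(α)` of all families `u` with `|u_k| = α_k` for all `k`. -/
def V (n : ℕ) {d : ℕ} (α : Fin d → ℕ) : Finset (Family n d) :=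
  Fintype.piFinset fun k => Finset.piAntidiag Finset.univ (α k)

theorem mem_V {n d : ℕ} {α : Fin d → ℕ} {u : Family n d} :
    u ∈ V n α ↔ ∀ k, ∑ γ, u k γ = α k := by
  simp [V]

/-- `g_i(u) = ∑_k ∑_{γ ∈ Δ_k^n} u_{k,γ} γ_i`. -/
def g {n d : ℕ} (u : Family n d) (i : Fin n) : ℕ :=
  ∑ k, ∑ γ, u k γ * γ.1 i

/-- The product `a! = a_1! ⋯ a_r!` of factorials of a tuple. -/
def tupleFactorial {ι : Type*} [Fintype ι] (a : ι → ℕ) : ℕ :=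
  ∏ i, (a i).factorial

/-- The iterated partial derivative `∂^γ P = ∂_1^{γ_1} ⋯ ∂_n^{γ_n} P`. -/
def partialDeriv {n : ℕ} (γ : Fin n → ℕ) (P : MvPolynomial (Fin n) ℝ) :
    MvPolynomial (Fin n) ℝ :=
  (List.finRange n).foldr (fun i R => (fun S => MvPolynomial.pderiv i S)^[γ i] R) P

/-- The point `ŷ(i) = (y_1, …, y_{i-1}, 1, y_{i+1}, …, y_n)`. -/
def hat {n : ℕ} (i : Fin n) (y : {k : Fin n // k ≠ i} → ℝ) : Fin n → ℝ :=
  fun k => if h : k ≠ i then y ⟨k, h⟩ else 1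

/-- The value at the point `x` of the polynomial
`α! / (∏_k u_k!) * ∏_k ∏_{γ ∈ Δ_k^n} (∂^γ P / γ!)^{u_{k,γ}}`. -/
def Pau {n d : ℕ} (P : MvPolynomial (Fin n) ℝ) (α : Fin d → ℕ) (u : Family n d)
    (x : Fin n → ℝ) : ℝ :=
  (tupleFactorial α : ℝ) / (∏ k, (tupleFactorial (u k) : ℝ)) *
    ∏ k, ∏ γ, (MvPolynomial.eval x (partialDeriv γ.1 P) / (tupleFactorial γ.1 : ℝ)) ^ u k γ

/-- The period
`K_i(P;Q;N;α,u,β) = ∫_{[0,1]^{n-1}} P(ŷ(i))^{N-|α|} P^i_{α,u}(ŷ(i)) (∂^β Q)(ŷ(i)) ∏_{k≠i} dy_k`. -/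
def period {n d : ℕ} (P Q : MvPolynomial (Fin n) ℝ) (N : ℕ) (α : Fin d → ℕ) (u : Family n d)
    (β : Fin n → ℕ) (i : Fin n) : ℝ :=
  ∫ y in Set.Icc (0 : {k : Fin n // k ≠ i} → ℝ) 1,
    MvPolynomial.eval (hat i y) P ^ ((N : ℤ) - ((∑ k, α k : ℕ) : ℤ)) *
      Pau P α u (hat i y) * MvPolynomial.eval (hat i y) (partialDeriv β Q)

/-- The modified Bernoulli numbers: `B̃_1 = -B_1 = 1/2` and `B̃_k = B_k` for `k ≠ 1`. -/
def modBernoulli (k : ℕ) : ℚ :=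
  if k = 1 then -bernoulli 1 else bernoulli k

end

end MahlerSeries

/-! The theorem is read off from the small-time expansion of the theta function $\theta(t)=\sum_m
Q(m)e^{-tP(m)}$. For $\Re s$ large, $\Gamma(s)Z(s)$ is the Mellin transform of $\theta$. If
$\theta(t)\sim\sum_j c_jt^{e_j}$ as $t\to0$, that transform continues meromorphically with terms
$c_j/(s+e_j)$. Since $1/\Gamma$ has a simple zero at $-N$ with derivative $(-1)^NN!$, only the term
with $e_j=N$ survives there, and $Z(-N)=(-1)^NN!\,c_j$ (`tendsto_mellinCont`).

To find $c_j$, put $h=t^{1/d}$. By homogeneity $h^{n+q}\theta(t)$ is the Riemann sum with mesh $h$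
of $Qe^{-P}$ over the orthant, sampled at upper corners. Euler–Maclaurin in each variable, with the
boundary terms kept as integrals of derivatives, gives $c_j=\sum_{|\delta|=j}\prod_i\frac{\widetilde
B_{\delta_i}}{\delta_i!}\int_{(0,\infty)^n}\partial^\delta(Qe^{-P})$ with $e_j=(j-n-q)/d$
(`theta_sub_isBigO`). Sampling at upper corners is what produces $\widetilde B_1=+\tfrac12$. The
exponent is $N$ exactly for $j=dN+q+n$.

To evaluate the integrals, note that $e^{P}\partial^\delta(Qe^{-P})/\delta!$ is the coefficient of
$a^\delta$ in $Q(x+a)\exp(P(x)-P(x+a))$. Expanding $Q$ by Taylor and the exponential as a product of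
exponential series yields the sum over $\beta$, $\alpha$, $u$ with $\delta=g(u)+\beta$
(`sum_mul_eval_twistTaylor`). Each summand is a homogeneous polynomial times $e^{-P}$, of degree
$d(|\alpha|-N)-n$. Polar coordinates for the sup norm turn its integral into $(|\alpha|-N-1)!/d$
times a sum of integrals over the faces $x_i=1$ of the unit cube, which are the periods
(`integral_family`). -/

namespace MahlerSeries

open Finset
open scoped Nat

/-! ### Iterated derivatives twisted by exp(-P). -/

/-- Apply each of the operators `D i` to `a` exactly `δ i` times. -/
def iterOp {n : ℕ} {A : Type*} (D : Fin n → A → A) (δ : Fin n → ℕ) (a : A) : A :=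
  (List.finRange n).foldr (fun i r => (D i)^[δ i] r) a

theorem iterOp_zero {n : ℕ} {A : Type*} (D : Fin n → A → A) (a : A) : iterOp D 0 a = a := by
  unfold iterOp
  induction List.finRange n with
  | nil => rfl
  | cons i l ih => simp

theorem foldr_iterate_add_single {n : ℕ} {A : Type*} (D : Fin n → A → A)
    (hD : ∀ i j, Function.Commute (D i) (D j)) (δ : Fin n → ℕ) (i : Fin n) (a : A)
    (l : List (Fin n)) (hl : l.Nodup) :
    l.foldr (fun j r => (D j)^[(δ + (Pi.single i 1 : Fin n → ℕ)) j] r) a =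
      if i ∈ l then D i (l.foldr (fun j r => (D j)^[δ j] r) a)
      else l.foldr (fun j r => (D j)^[δ j] r) a := by
  induction l with
  | nil => simp
  | cons k l ih =>
    rw [List.nodup_cons] at hl
    simp only [List.foldr_cons, ih hl.2, List.mem_cons]
    by_cases hk : i = k
    · subst hk
      simp [hl.1, Function.iterate_succ_apply']
    · have hk' : k ≠ i := fun h => hk h.symm
      by_cases hi : i ∈ l
      · simp only [hi, hk, or_true, if_true, Pi.add_apply, Pi.single_eq_of_ne hk', add_zero]
        exact (hD k i).iterate_left _ _
      · simp [hi, hk]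

theorem iterOp_add_single {n : ℕ} {A : Type*} {D : Fin n → A → A}
    (hD : ∀ i j, Function.Commute (D i) (D j)) (δ : Fin n → ℕ) (i : Fin n) (a : A) :
    iterOp D (δ + Pi.single i 1) a = D i (iterOp D δ a) := by
  unfold iterOp
  rw [foldr_iterate_add_single D hD δ i a _ (List.nodup_finRange n)]
  simp

theorem multiIndex_induction {n : ℕ} {p : (Fin n → ℕ) → Prop} (zero : p 0)
    (step : ∀ δ i, p δ → p (δ + Pi.single i 1)) (δ : Fin n → ℕ) : p δ := by
  induction h : ∑ i, δ i generalizing δ with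
  | zero =>
    have : δ = 0 := by
      ext i
      simpa using (Finset.sum_eq_zero_iff.1 h) i (mem_univ i)
    exact this ▸ zero
  | succ k ih =>
    obtain ⟨i, -, hi⟩ : ∃ i ∈ univ, δ i ≠ 0 := by
      by_contra! hc
      rw [Finset.sum_eq_zero hc] at h
      omega
    have h1 : δ = (δ - Pi.single i 1) + Pi.single i 1 := by
      ext j
      by_cases hj : j = i
      · subst hj
        simp
        omega
      · simp [Pi.single_eq_of_ne hj]
    rw [h1]
    apply step
    apply ih
    have : ∑ j, δ j = ∑ j, ((δ - (Pi.single i 1 : Fin n → ℕ)) j + (Pi.single i 1 : Fin n → ℕ) j) :=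
      Finset.sum_congr rfl fun j _ => congrFun h1 j
    rw [Finset.sum_add_distrib] at this
    simp only [Finset.sum_pi_single', mem_univ, if_true] at this
    omega

theorem iterOp_add_of_commute {n : ℕ} {A : Type*} {D : Fin n → A → A}
    (hD : ∀ i j, Function.Commute (D i) (D j)) (δ : Fin n → ℕ) (i : Fin n) (a : A) :
    iterOp D δ (D i a) = iterOp D (δ + Pi.single i 1) a := by
  induction δ using multiIndex_induction with
  | zero => rw [iterOp_zero, iterOp_add_single hD, iterOp_zero]
  | step δ j ih =>
    rw [iterOp_add_single hD, ih, add_right_comm, iterOp_add_single hD _ j]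

theorem tupleFactorial_ne_zero {ι : Type*} [Fintype ι] (a : ι → ℕ) :
    (tupleFactorial a : ℝ) ≠ 0 := by
  unfold tupleFactorial
  exact_mod_cast Finset.prod_ne_zero_iff.2 fun i _ => Nat.factorial_ne_zero _

theorem tupleFactorial_zero {ι : Type*} [Fintype ι] : tupleFactorial (0 : ι → ℕ) = 1 := by
  simp [tupleFactorial]

theorem tupleFactorial_add_single {ι : Type*} [Fintype ι] [DecidableEq ι] (a : ι → ℕ) (i : ι) :
    tupleFactorial (a + Pi.single i 1) = (a i + 1) * tupleFactorial a := by
  unfold tupleFactorial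
  rw [← Finset.mul_prod_erase _ _ (mem_univ i), ← Finset.mul_prod_erase _ (fun j => (a j)!) (mem_univ i),
    ← mul_assoc]
  congr 1
  · simp [Nat.factorial_succ]
  · refine Finset.prod_congr rfl fun j hj => ?_
    simp [Pi.single_eq_of_ne (Finset.ne_of_mem_erase hj)]

/-- The conjugate of the partial derivative `∂_i` by multiplication with `exp (-P)`. -/
noncomputable def twist {n : ℕ} (P : MvPolynomial (Fin n) ℝ) (i : Fin n)
    (G : MvPolynomial (Fin n) ℝ) : MvPolynomial (Fin n) ℝ :=
  MvPolynomial.pderiv i G - G * MvPolynomial.pderiv i P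

theorem pderiv_commute {n : ℕ} (i j : Fin n) :
    Function.Commute (fun G : MvPolynomial (Fin n) ℝ => MvPolynomial.pderiv i G)
      (fun G => MvPolynomial.pderiv j G) := by
  intro G
  -- The commutator of two derivations is a derivation, so it suffices that it kills the variables.
  have h : ⁅(MvPolynomial.pderiv (R := ℝ) i), MvPolynomial.pderiv (R := ℝ) j⁆ = 0 := by
    apply MvPolynomial.derivation_ext
    intro k
    simp only [Derivation.commutator_apply, MvPolynomial.pderiv_X, Derivation.coe_zero,
      Pi.zero_apply]
    by_cases h1 : k = i <;> by_cases h2 : k = j <;> simp [Pi.single_apply, h1, h2, apply_ite]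
  have := congrArg (fun D => D G) h
  simpa [Derivation.commutator_apply, sub_eq_zero] using this

/-- The operators are conjugates of commuting partial derivatives; after expansion only the mixed
partials of `G` and of `P` have to be exchanged. -/
theorem twist_commute {n : ℕ} (P : MvPolynomial (Fin n) ℝ) (i j : Fin n) :
    Function.Commute (twist P i) (twist P j) := by
  intro G
  have h1 := pderiv_commute i j G
  have h2 := pderiv_commute i j P
  simp only at h1 h2
  simp only [twist, map_sub, Derivation.leibniz, smul_eq_mul]
  rw [h1, h2]
  ring

theorem partialDeriv_eq_iterOp {n : ℕ} (γ : Fin n → ℕ) (P : MvPolynomial (Fin n) ℝ) :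
    partialDeriv γ P = iterOp (fun i G => MvPolynomial.pderiv i G) γ P := rfl

/-- The coefficient `∂^γ P / γ!` of the Taylor expansion of `P`. -/
noncomputable def taylor {n : ℕ} (P : MvPolynomial (Fin n) ℝ) (γ : Fin n → ℕ) :
    MvPolynomial (Fin n) ℝ :=
  (tupleFactorial γ : ℝ)⁻¹ • partialDeriv γ P

/-- The coefficient of `a^δ` in the Taylor expansion of `a ↦ G(x + a) exp (P(x) - P(x + a))`. -/
noncomputable def twistTaylor {n : ℕ} (P G : MvPolynomial (Fin n) ℝ) (δ : Fin n → ℕ) :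
    MvPolynomial (Fin n) ℝ :=
  (tupleFactorial δ : ℝ)⁻¹ • iterOp (twist P) δ G

theorem twist_smul {n : ℕ} (P : MvPolynomial (Fin n) ℝ) (i : Fin n) (c : ℝ)
    (G : MvPolynomial (Fin n) ℝ) : twist P i (c • G) = c • twist P i G := by
  simp [twist, smul_sub]

theorem add_one_smul_taylor {n : ℕ} (P : MvPolynomial (Fin n) ℝ) (γ : Fin n → ℕ) (i : Fin n) :
    ((γ i : ℝ) + 1) • taylor P (γ + Pi.single i 1) = MvPolynomial.pderiv i (taylor P γ) := by
  unfold taylor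
  rw [partialDeriv_eq_iterOp, partialDeriv_eq_iterOp, iterOp_add_single pderiv_commute,
    Derivation.map_smul, smul_smul, tupleFactorial_add_single]
  congr 1
  have : (γ i : ℝ) + 1 ≠ 0 := by positivity
  push_cast
  field_simp

theorem add_one_smul_twistTaylor {n : ℕ} (P G : MvPolynomial (Fin n) ℝ) (γ : Fin n → ℕ)
    (i : Fin n) :
    ((γ i : ℝ) + 1) • twistTaylor P G (γ + Pi.single i 1) = twist P i (twistTaylor P G γ) := by
  unfold twistTaylor
  rw [iterOp_add_single (twist_commute P), twist_smul, smul_smul, tupleFactorial_add_single]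
  congr 1
  have : (γ i : ℝ) + 1 ≠ 0 := by positivity
  push_cast
  field_simp

end MahlerSeries

/-! ### Leibniz rule and recursion for the twisted Taylor coefficients. -/

namespace MahlerSeries

open Finset
open scoped Nat

theorem add_single_sub {n : ℕ} {δ β : Fin n → ℕ} (h : β ≤ δ) (i : Fin n) :
    δ + Pi.single i 1 - β = (δ - β) + Pi.single i 1 := by
  ext j
  have h1 : β j ≤ δ j := h j
  simp only [Pi.add_apply, Pi.sub_apply]
  omega

/-- The weight kills the face `β i = 0`, and the remaining indices are shifts by a unit vector. The
companion below kills the opposite face; together they give Pascal's rule in the Leibniz formula. -/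
theorem sum_Iic_add_single_smul {n : ℕ}
    (δ : Fin n → ℕ) (i : Fin n) (f : (Fin n → ℕ) → MvPolynomial (Fin n) ℝ) :
    ∑ β ∈ Iic (δ + Pi.single i 1), (β i : ℝ) • f β =
      ∑ β ∈ Iic δ, ((β i : ℝ) + 1) • f (β + Pi.single i 1) := by
  symm
  have hinj : Set.InjOn (fun β : Fin n → ℕ => β + Pi.single i 1) (Iic δ : Finset (Fin n → ℕ)) :=
    fun a _ b _ h => add_right_cancel h
  have := Finset.sum_image (s := Iic δ) (f := fun β : Fin n → ℕ => (β i : ℝ) • f β) hinj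
  simp only [Pi.add_apply, Pi.single_eq_same, Nat.cast_add, Nat.cast_one] at this
  rw [← this]
  apply Finset.sum_subset
  · intro β hβ
    obtain ⟨a, ha, rfl⟩ := Finset.mem_image.1 hβ
    exact Finset.mem_Iic.2 (add_le_add_left (Finset.mem_Iic.1 ha) _)
  · intro β hβ hβ'
    have h0 : β i = 0 := by
      by_contra hne
      apply hβ'
      refine Finset.mem_image.2 ⟨β - Pi.single i 1, Finset.mem_Iic.2 ?_, ?_⟩
      · exact tsub_le_iff_right.2 (Finset.mem_Iic.1 hβ)
      · ext j
        by_cases hj : j = i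
        · subst hj
          simp
          omega
        · simp [Pi.single_eq_of_ne hj]
    simp [h0]

theorem sum_Iic_add_single_sub_smul {n : ℕ}
    (δ : Fin n → ℕ) (i : Fin n) (f : (Fin n → ℕ) → MvPolynomial (Fin n) ℝ) :
    ∑ β ∈ Iic (δ + Pi.single i 1), ((δ i : ℝ) + 1 - β i) • f β =
      ∑ β ∈ Iic δ, ((δ i : ℝ) + 1 - β i) • f β := by
  symm
  apply Finset.sum_subset
  · exact Finset.Iic_subset_Iic.2 (le_add_of_nonneg_right (by simp))
  · intro β hβ hβ'
    have h0 : β i = δ i + 1 := by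
      by_contra hne
      apply hβ'
      refine Finset.mem_Iic.2 fun j => ?_
      have h1 : β j ≤ δ j + (Pi.single i 1 : Fin n → ℕ) j := Finset.mem_Iic.1 hβ j
      by_cases hj : j = i
      · subst hj
        rw [Pi.single_eq_same] at h1
        exact Nat.le_of_lt_succ (lt_of_le_of_ne h1 hne)
      · simpa [Pi.single_eq_of_ne hj] using h1
    simp [h0]

theorem twist_mul {n : ℕ} (P : MvPolynomial (Fin n) ℝ) (i : Fin n)
    (F G : MvPolynomial (Fin n) ℝ) :
    twist P i (F * G) = MvPolynomial.pderiv i F * G + F * twist P i G := by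
  simp only [twist, Derivation.leibniz, smul_eq_mul]
  ring

theorem twist_sum {n : ℕ} {ι : Type*} (P : MvPolynomial (Fin n) ℝ) (i : Fin n) (s : Finset ι)
    (f : ι → MvPolynomial (Fin n) ℝ) :
    twist P i (∑ k ∈ s, f k) = ∑ k ∈ s, twist P i (f k) := by
  simp [twist, Finset.sum_sub_distrib, Finset.sum_mul]

theorem taylor_zero {n : ℕ} (P : MvPolynomial (Fin n) ℝ) : taylor P 0 = P := by
  simp [taylor, tupleFactorial_zero, partialDeriv_eq_iterOp, iterOp_zero]

theorem twistTaylor_zero {n : ℕ} (P G : MvPolynomial (Fin n) ℝ) : twistTaylor P G 0 = G := by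
  simp [twistTaylor, tupleFactorial_zero, iterOp_zero]

/-- The factor exp(P(x) - P(x+a)) can be attached to `G` alone, so this is the Cauchy product of two
power series in `a`. -/
theorem twistTaylor_mul {n : ℕ} (P F G : MvPolynomial (Fin n) ℝ) (δ : Fin n → ℕ) :
    twistTaylor P (F * G) δ = ∑ β ∈ Iic δ, taylor F β * twistTaylor P G (δ - β) := by
  induction δ using multiIndex_induction with
  | zero =>
    have : (Iic (0 : Fin n → ℕ)) = {0} := by
      ext β
      rw [Finset.mem_Iic, Finset.mem_singleton]
      exact nonpos_iff_eq_zero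
    simp [this, taylor_zero, twistTaylor_zero]
  | step δ i ih =>
    have hne : ((δ i : ℝ) + 1) ≠ 0 := by positivity
    -- Multiply by `δ i + 1` to clear the factorial, then split this factor as `β i` plus `δ i + 1 -
    -- β i`: the first part differentiates `F`, the second `G`.
    have key : ((δ i : ℝ) + 1) • twistTaylor P (F * G) (δ + Pi.single i 1) =
        ((δ i : ℝ) + 1) • ∑ β ∈ Iic (δ + Pi.single i 1),
          taylor F β * twistTaylor P G (δ + Pi.single i 1 - β) := by
      rw [add_one_smul_twistTaylor, ih, twist_sum]
      have e1 : ∀ β ∈ Iic δ, twist P i (taylor F β * twistTaylor P G (δ - β)) =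
          ((β i : ℝ) + 1) • (taylor F (β + Pi.single i 1) *
            twistTaylor P G (δ + Pi.single i 1 - (β + Pi.single i 1))) +
          ((δ i : ℝ) + 1 - β i) • (taylor F β * twistTaylor P G (δ + Pi.single i 1 - β)) := by
        intro β hβ
        have hβ' := Finset.mem_Iic.1 hβ
        rw [twist_mul, ← add_one_smul_taylor, ← add_one_smul_twistTaylor, add_single_sub hβ',
          add_tsub_add_eq_tsub_right, smul_mul_assoc, mul_smul_comm]
        have h1 : ((δ - β) i : ℝ) + 1 = (δ i : ℝ) + 1 - β i := by
          rw [Pi.sub_apply, Nat.cast_sub (hβ' i)]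
          ring
        rw [h1]
      rw [Finset.sum_congr rfl e1, Finset.sum_add_distrib]
      have h1 := sum_Iic_add_single_smul δ i
        (fun β => taylor F β * twistTaylor P G (δ + Pi.single i 1 - β))
      have h2 := sum_Iic_add_single_sub_smul δ i
        (fun β => taylor F β * twistTaylor P G (δ + Pi.single i 1 - β))
      rw [← h1, ← h2, ← Finset.sum_add_distrib, Finset.smul_sum]
      refine Finset.sum_congr rfl fun β _ => ?_
      rw [← add_smul]
      congr 1
      ring
    have := congrArg (fun A => ((δ i : ℝ) + 1)⁻¹ • A) key
    simpa [smul_smul, hne] using this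

theorem twistTaylor_smul {n : ℕ} (P G : MvPolynomial (Fin n) ℝ) (c : ℝ) (δ : Fin n → ℕ) :
    twistTaylor P (c • G) δ = c • twistTaylor P G δ := by
  have : iterOp (twist P) δ (c • G) = c • iterOp (twist P) δ G := by
    induction δ using multiIndex_induction with
    | zero => simp [iterOp_zero]
    | step δ i ih =>
      rw [iterOp_add_single (twist_commute P), ih, twist_smul,
        iterOp_add_single (twist_commute P)]
  rw [twistTaylor, twistTaylor, this, smul_comm]

/-- Here the extra twist acts first, directly on `G`, so that for `G = 1` the derivative of `P`
becomes visible. -/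
theorem add_one_smul_twistTaylor' {n : ℕ} (P G : MvPolynomial (Fin n) ℝ) (γ : Fin n → ℕ)
    (i : Fin n) :
    ((γ i : ℝ) + 1) • twistTaylor P G (γ + Pi.single i 1) = twistTaylor P (twist P i G) γ := by
  rw [twistTaylor, twistTaylor, iterOp_add_of_commute (twist_commute P), smul_smul,
    tupleFactorial_add_single]
  congr 1
  have : (γ i : ℝ) + 1 ≠ 0 := by positivity
  push_cast
  field_simp

theorem taylor_pderiv {n : ℕ} (P : MvPolynomial (Fin n) ℝ) (γ : Fin n → ℕ) (i : Fin n) :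
    taylor (MvPolynomial.pderiv i P) γ = ((γ i : ℝ) + 1) • taylor P (γ + Pi.single i 1) := by
  rw [taylor, taylor, partialDeriv_eq_iterOp, partialDeriv_eq_iterOp,
    iterOp_add_of_commute (D := fun i G => MvPolynomial.pderiv i G) pderiv_commute, smul_smul,
    tupleFactorial_add_single]
  congr 1
  have : (γ i : ℝ) + 1 ≠ 0 := by positivity
  push_cast
  field_simp

/-- The recursion `ε_i E_ε = - ∑_γ γ_i p_γ E_{ε - γ}` for the coefficients of
`exp (- ∑_{γ ≠ 0} p_γ a^γ)`. -/
theorem smul_twistTaylor_one {n : ℕ} (P : MvPolynomial (Fin n) ℝ) (ε : Fin n → ℕ) (i : Fin n) :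
    (ε i : ℝ) • twistTaylor P 1 ε =
      - ∑ γ ∈ Iic ε, (γ i : ℝ) • (taylor P γ * twistTaylor P 1 (ε - γ)) := by
  by_cases h : ε i = 0
  · rw [Finset.sum_eq_zero, h]
    · simp
    · intro γ hγ
      have h1 : γ i ≤ ε i := Finset.mem_Iic.1 hγ i
      have h0 : γ i = 0 := by omega
      simp [h0]
  · have h1 : ε = (ε - Pi.single i 1) + Pi.single i 1 := by
      ext j
      by_cases hj : j = i
      · subst hj
        simp
        omega
      · simp [Pi.single_eq_of_ne hj]
    generalize ε - Pi.single i 1 = δ at h1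
    subst h1
    have h3 := sum_Iic_add_single_smul δ i
      (fun γ => taylor P γ * twistTaylor P 1 (δ + Pi.single i 1 - γ))
    rw [h3]
    simp only [Pi.add_apply, Pi.single_eq_same, Nat.cast_add, Nat.cast_one]
    -- The superfluous factor 1 lets the Leibniz rule apply, with the twist carried by the constant
    -- polynomial.
    have h2 : twist P i 1 = (-1 : ℝ) • (MvPolynomial.pderiv i P * 1) := by
      simp [twist]
    rw [add_one_smul_twistTaylor', h2, twistTaylor_smul, twistTaylor_mul, neg_one_smul]
    congr 1
    refine Finset.sum_congr rfl fun β _ => ?_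
    rw [taylor_pderiv, smul_mul_assoc, add_tsub_add_eq_tsub_right]

end MahlerSeries

/-! ### Coefficients of the exponential as sums over families of multiplicities. -/

namespace MahlerSeries

open Finset
open scoped Nat

instance decidableLEMultiIndex {n : ℕ} (a b : Fin n → ℕ) : Decidable (a ≤ b) :=
  inferInstanceAs (Decidable (∀ i, a i ≤ b i))

/-- The families `u` of multiplicities with `∑_i u_i w_i = ε`. -/
def weighted {n : ℕ} {I : Type*} [Fintype I] [DecidableEq I] (w : I → Fin n → ℕ)
    (ε : Fin n → ℕ) : Finset (I → ℕ) :=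
  (Fintype.piFinset fun _ : I => range (∑ j, ε j + 1)).filter fun u => ∑ i, u i • w i = ε

/-- As no weight is zero, each `u i` is at most the total size of `ε`; the finite box in the
definition cuts nothing off. -/
theorem mem_weighted {n : ℕ} {I : Type*} [Fintype I] [DecidableEq I] {w : I → Fin n → ℕ}
    (hw : ∀ i, w i ≠ 0) {ε : Fin n → ℕ} {u : I → ℕ} :
    u ∈ weighted w ε ↔ ∑ i, u i • w i = ε := by
  simp only [weighted, Finset.mem_filter, Fintype.mem_piFinset, Finset.mem_range,
    and_iff_right_iff_imp]
  rintro rfl i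
  obtain ⟨j, hj⟩ := Function.ne_iff.1 (hw i)
  have h1 : u i * w i j ≤ (∑ i, u i • w i) j := by
    rw [Finset.sum_apply]
    exact Finset.single_le_sum (f := fun i => u i * w i j) (fun _ _ => Nat.zero_le _) (mem_univ i)
  have h2 : (∑ i, u i • w i) j ≤ ∑ j, (∑ i, u i • w i) j :=
    Finset.single_le_sum (f := fun j => (∑ i, u i • w i) j) (fun _ _ => Nat.zero_le _)
      (mem_univ j)
  have h3 : u i ≤ u i * w i j := Nat.le_mul_of_pos_right _ (Nat.pos_of_ne_zero hj)
  omega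

/-- The product of the divided powers `c_i^{u_i} / u_i!`. -/
noncomputable def dividedPow {I : Type*} [Fintype I] (c : I → ℝ) (u : I → ℕ) : ℝ :=
  ∏ i, (c i ^ u i / (u i)!)

theorem dividedPow_add_single {I : Type*} [Fintype I] [DecidableEq I] (c : I → ℝ) (u : I → ℕ)
    (i : I) : ((u i : ℝ) + 1) * dividedPow c (u + Pi.single i 1) = c i * dividedPow c u := by
  unfold dividedPow
  rw [← Finset.mul_prod_erase _ _ (mem_univ i), ← Finset.mul_prod_erase _ (fun j => c j ^ u j / (u j)!)
    (mem_univ i)]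
  rw [Finset.prod_congr rfl (g := fun j => c j ^ u j / (u j)!)]
  · simp only [Pi.add_apply, Pi.single_eq_same, Nat.factorial_succ, pow_succ]
    push_cast
    have : (u i : ℝ) + 1 ≠ 0 := by positivity
    field_simp
  · intro j hj
    simp [Pi.single_eq_of_ne (Finset.ne_of_mem_erase hj)]

/-- Removing one copy of `i` turns `u i` times a divided power into `c i` times a divided power of
weight `ε - w i`; families without a copy of `i` contribute zero. -/
theorem sum_weighted_mul_dividedPow {n : ℕ} {I : Type*} [Fintype I] [DecidableEq I]
    {w : I → Fin n → ℕ} (hw : ∀ i, w i ≠ 0) (c : I → ℝ) (ε : Fin n → ℕ) (i : I) :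
    ∑ u ∈ weighted w ε, (u i : ℝ) * dividedPow c u =
      if w i ≤ ε then c i * ∑ u ∈ weighted w (ε - w i), dividedPow c u else 0 := by
  have hsum : ∀ u : I → ℕ, ∑ k, (u + (Pi.single i 1 : I → ℕ)) k • w k = ∑ k, u k • w k + w i := by
    intro u
    simp only [Pi.add_apply, add_smul, Finset.sum_add_distrib]
    congr 1
    rw [Finset.sum_eq_single i]
    · simp
    · intro k _ hk
      simp [Pi.single_eq_of_ne hk]
    · simp
  have hsub : ∀ u : I → ℕ, u i ≠ 0 → u - Pi.single i 1 + Pi.single i 1 = u := by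
    intro u hu
    ext k
    by_cases hk : k = i
    · subst hk
      simp
      omega
    · simp [Pi.single_eq_of_ne hk]
  split_ifs with h
  · rw [Finset.mul_sum]
    symm
    have hinj : Set.InjOn (fun u : I → ℕ => u + Pi.single i 1)
        (weighted w (ε - w i) : Finset (I → ℕ)) := fun a _ b _ h => add_right_cancel h
    have him := Finset.sum_image (f := fun u : I → ℕ => (u i : ℝ) * dividedPow c u) hinj
    simp only [Pi.add_apply, Pi.single_eq_same, Nat.cast_add, Nat.cast_one,
      dividedPow_add_single] at him
    rw [← him]
    apply Finset.sum_subset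
    · intro u hu
      obtain ⟨v, hv, rfl⟩ := Finset.mem_image.1 hu
      rw [mem_weighted hw] at hv ⊢
      rw [hsum, hv, tsub_add_cancel_of_le h]
    · intro u hu hu'
      have h0 : u i = 0 := by
        by_contra hne
        apply hu'
        refine Finset.mem_image.2 ⟨u - Pi.single i 1, ?_, hsub u hne⟩
        rw [mem_weighted hw] at hu ⊢
        rw [← hsub u hne, hsum] at hu
        rw [← hu, add_tsub_cancel_right]
      simp [h0]
  · apply Finset.sum_eq_zero
    intro u hu
    have h0 : u i = 0 := by
      by_contra hne
      apply h
      rw [mem_weighted hw, ← hsub u hne, hsum] at hu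
      rw [← hu]
      exact le_add_of_nonneg_left (by simp)
    simp [h0]

/-- This is the Euler operator $a_j\partial/\partial a_j$ applied to $\exp(\sum_i c_ia^{w_i})$, read
on coefficients. -/
theorem mul_sum_dividedPow {n : ℕ} {I : Type*} [Fintype I] [DecidableEq I]
    {w : I → Fin n → ℕ} (hw : ∀ i, w i ≠ 0) (c : I → ℝ) (ε : Fin n → ℕ) (j : Fin n) :
    (ε j : ℝ) * ∑ u ∈ weighted w ε, dividedPow c u =
      ∑ i, if w i ≤ ε then (w i j : ℝ) * (c i * ∑ u ∈ weighted w (ε - w i), dividedPow c u)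
        else 0 := by
  have h1 : ∀ u ∈ weighted w ε, (ε j : ℝ) * dividedPow c u =
      ∑ i, (w i j : ℝ) * ((u i : ℝ) * dividedPow c u) := by
    intro u hu
    rw [mem_weighted hw] at hu
    conv_lhs => rw [← hu]
    rw [Finset.sum_apply, Nat.cast_sum, Finset.sum_mul]
    refine Finset.sum_congr rfl fun i _ => ?_
    simp
    ring
  rw [Finset.mul_sum, Finset.sum_congr rfl h1, Finset.sum_comm]
  refine Finset.sum_congr rfl fun i _ => ?_
  rw [← Finset.mul_sum, sum_weighted_mul_dividedPow hw]
  split_ifs <;> simp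

/-- The recursion determines every coefficient from `E 0`: for `ε ≠ 0` use a coordinate with `ε j ≠
0`, and all weights being nonzero, only smaller indices occur. -/
theorem eq_sum_dividedPow {n : ℕ} {I : Type*} [Fintype I] [DecidableEq I]
    {w : I → Fin n → ℕ} (hw : ∀ i, w i ≠ 0) (c : I → ℝ) {E : (Fin n → ℕ) → ℝ} (hE0 : E 0 = 1)
    (hE : ∀ ε j, (ε j : ℝ) * E ε = ∑ i, if w i ≤ ε then (w i j : ℝ) * (c i * E (ε - w i)) else 0)
    (ε : Fin n → ℕ) : E ε = ∑ u ∈ weighted w ε, dividedPow c u := by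
  induction h : ∑ i, ε i using Nat.strong_induction_on generalizing ε with
  | _ k ih =>
    by_cases hε : ε = 0
    · subst hε
      have : weighted w 0 = {0} := by
        ext u
        rw [mem_weighted hw, Finset.mem_singleton]
        constructor
        · intro hu
          ext i
          have h1 := (Finset.sum_eq_zero_iff.1 hu) i (mem_univ i)
          exact (smul_eq_zero.1 h1).resolve_right (hw i)
        · rintro rfl
          simp
      rw [this, hE0]
      simp [dividedPow]
    · obtain ⟨j, hj⟩ := Function.ne_iff.1 hε
      have hj' : (ε j : ℝ) ≠ 0 := Nat.cast_ne_zero.2 hj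
      apply mul_left_cancel₀ hj'
      rw [hE, mul_sum_dividedPow hw]
      refine Finset.sum_congr rfl fun i _ => ?_
      split_ifs with hi
      · rw [ih (∑ j, (ε - w i) j) ?_ _ rfl]
        rw [← h]
        obtain ⟨l, hl⟩ := Function.ne_iff.1 (hw i)
        have hl' : w i l ≠ 0 := hl
        refine Finset.sum_lt_sum (fun m _ => Nat.sub_le _ _) ⟨l, mem_univ l, ?_⟩
        have h1 : w i l ≤ ε l := hi l
        simp only [Pi.sub_apply]
        omega
      · rfl

theorem partialDeriv_add_single {n : ℕ} (P : MvPolynomial (Fin n) ℝ) (γ : Fin n → ℕ)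
    (i : Fin n) :
    partialDeriv (γ + Pi.single i 1) P = MvPolynomial.pderiv i (partialDeriv γ P) :=
  iterOp_add_single pderiv_commute γ i P

theorem isHomogeneous_partialDeriv {n d : ℕ} {P : MvPolynomial (Fin n) ℝ}
    (hP : P.IsHomogeneous d) (γ : Fin n → ℕ) :
    (partialDeriv γ P).IsHomogeneous (d - ∑ i, γ i) ∧
      (d < ∑ i, γ i → partialDeriv γ P = 0) := by
  induction γ using multiIndex_induction with
  | zero =>
    rw [partialDeriv_eq_iterOp, iterOp_zero]
    simpa using hP
  | step γ i ih =>
    rw [partialDeriv_add_single]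
    have hs : ∑ k, (γ + (Pi.single i 1 : Fin n → ℕ)) k = ∑ k, γ k + 1 := by
      simp [Finset.sum_add_distrib]
    rw [hs]
    refine ⟨by simpa [Nat.sub_sub] using ih.1.pderiv (i := i), fun h => ?_⟩
    rcases Nat.lt_or_ge d (∑ k, γ k) with h1 | h1
    · rw [ih.2 h1, map_zero]
    -- The order is exactly `d`, where the derivative has become a constant; one more derivative
    -- kills it.
    · have h2 := ih.1
      rw [show d - ∑ k, γ k = 0 by omega] at h2
      have h3 := (MvPolynomial.totalDegree_zero_iff_isHomogeneous _).2 h2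
      rw [MvPolynomial.totalDegree_eq_zero_iff_eq_C.1 h3, MvPolynomial.pderiv_C]

/-- The index set of all families `u`, as pairs `(k, γ)` with `γ ∈ Δ_{k+1}^n`. -/
abbrev PairIndex (n d : ℕ) : Type :=
  (k : Fin d) × {γ : Fin n → ℕ // γ ∈ Delta n ((k : ℕ) + 1)}

theorem PairIndex.val_ne_zero {n d : ℕ} (p : PairIndex n d) : p.2.1 ≠ 0 := by
  intro h
  have := mem_Delta.1 p.2.2
  rw [h] at this
  simp at this

/-- Both sides satisfy the same recursion. In the sum over all `γ ≤ ε`, the term `γ = 0` carries the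
factor `γ j = 0` and the terms with |γ| > d vanish, so exactly the pairs of `PairIndex` remain, each
`γ` occurring once. -/
theorem eval_twistTaylor_one {n d : ℕ} {P : MvPolynomial (Fin n) ℝ} (hP : P.IsHomogeneous d)
    (x : Fin n → ℝ) (ε : Fin n → ℕ) :
    MvPolynomial.eval x (twistTaylor P 1 ε) =
      ∑ u ∈ weighted (fun p : PairIndex n d => p.2.1) ε,
        dividedPow (fun p => - MvPolynomial.eval x (taylor P p.2.1)) u := by
  refine eq_sum_dividedPow (E := fun ε => MvPolynomial.eval x (twistTaylor P 1 ε))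
    PairIndex.val_ne_zero _ ?_ ?_ ε
  · simp [twistTaylor_zero]
  · intro ε j
    have h1 := congrArg (MvPolynomial.eval x) (smul_twistTaylor_one P ε j)
    simp only [MvPolynomial.smul_eval, map_neg, map_sum, map_mul] at h1
    rw [h1, ← Finset.sum_neg_distrib, ← Finset.sum_filter]
    have hinj : Set.InjOn (fun p : PairIndex n d => p.2.1)
        (univ.filter fun p : PairIndex n d => p.2.1 ≤ ε : Finset (PairIndex n d)) := by
      rintro ⟨k, γ, hγ⟩ _ ⟨k', γ', hγ'⟩ _ h
      simp only at h
      subst h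
      have h1 := mem_Delta.1 hγ
      have h2 := mem_Delta.1 hγ'
      have h3 : k = k' := Fin.ext (by omega)
      subst h3
      rfl
    have him := Finset.sum_image (M := ℝ) (f := fun γ : Fin n → ℕ => (γ j : ℝ) *
      (-MvPolynomial.eval x (taylor P γ) * MvPolynomial.eval x (twistTaylor P 1 (ε - γ)))) hinj
    rw [← him]
    symm
    have hneg : ∀ γ ∈ Iic ε, -((γ j : ℝ) * (MvPolynomial.eval x (taylor P γ) *
        MvPolynomial.eval x (twistTaylor P 1 (ε - γ)))) = (γ j : ℝ) *
      (-MvPolynomial.eval x (taylor P γ) * MvPolynomial.eval x (twistTaylor P 1 (ε - γ))) := by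
      intro γ _
      ring
    rw [Finset.sum_congr rfl hneg]
    apply Finset.sum_subset
    · intro γ hγ
      obtain ⟨p, hp, rfl⟩ := Finset.mem_image.1 hγ
      exact Finset.mem_Iic.2 (Finset.mem_filter.1 hp).2
    · intro γ hγ hγ'
      by_cases h0 : γ = 0
      · simp [h0]
      by_cases hd : d < ∑ i, γ i
      · rw [taylor, (isHomogeneous_partialDeriv hP γ).2 hd]
        simp
      exfalso
      have hs : ∑ i, γ i ≠ 0 := by
        intro h
        apply h0
        ext i
        exact (Finset.sum_eq_zero_iff.1 h) i (mem_univ i)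
      apply hγ'
      refine Finset.mem_image.2 ⟨⟨⟨∑ i, γ i - 1, by omega⟩, ⟨γ, ?_⟩⟩, ?_, rfl⟩
      · rw [mem_Delta]
        simp only
        omega
      · exact Finset.mem_filter.2 ⟨mem_univ _, Finset.mem_Iic.1 hγ⟩

theorem sum_smul_eq_g {n d : ℕ} (u : Family n d) :
    (∑ p : PairIndex n d, u p.1 p.2 • p.2.1) = g u := by
  ext i
  rw [Finset.sum_apply, Fintype.sum_sigma]
  simp [g]

theorem sum_g {n d : ℕ} {α : Fin d → ℕ} {u : Family n d} (hu : u ∈ V n α) :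
    ∑ i, g u i = ∑ k : Fin d, ((k : ℕ) + 1) * α k := by
  unfold g
  rw [Finset.sum_comm]
  refine Finset.sum_congr rfl fun k _ => ?_
  rw [Finset.sum_comm, ← mem_V.1 hu k, Finset.mul_sum]
  refine Finset.sum_congr rfl fun γ _ => ?_
  rw [← Finset.mul_sum, mem_Delta.1 γ.2, mul_comm]

theorem dividedPow_eq_Pau {n d : ℕ} (P : MvPolynomial (Fin n) ℝ) (x : Fin n → ℝ)
    {α : Fin d → ℕ} {u : Family n d} (hu : u ∈ V n α) :
    dividedPow (fun p : PairIndex n d => - MvPolynomial.eval x (taylor P p.2.1))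
      (fun p => u p.1 p.2) = (-1) ^ (∑ k, α k) / (tupleFactorial α : ℝ) * Pau P α u x := by
  unfold dividedPow Pau
  have hα := tupleFactorial_ne_zero α
  have h1 : ∀ k : Fin d, ∏ γ : {γ : Fin n → ℕ // γ ∈ Delta n ((k : ℕ) + 1)},
      ((- MvPolynomial.eval x (taylor P γ.1)) ^ u k γ / ((u k γ)! : ℝ)) =
      (-1) ^ α k * ((tupleFactorial (u k) : ℝ)⁻¹ * ∏ γ,
        (MvPolynomial.eval x (partialDeriv γ.1 P) / (tupleFactorial γ.1 : ℝ)) ^ u k γ) := by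
    intro k
    rw [Finset.prod_div_distrib, div_eq_inv_mul, ← mem_V.1 hu k, ← Finset.prod_pow_eq_pow_sum]
    rw [mul_left_comm, ← Finset.prod_mul_distrib]
    congr 1
    · simp [tupleFactorial]
    · refine Finset.prod_congr rfl fun γ _ => ?_
      rw [neg_pow, taylor, MvPolynomial.smul_eval, div_eq_inv_mul]
  rw [Fintype.prod_sigma, Finset.prod_congr rfl fun k _ => h1 k, Finset.prod_mul_distrib,
    Finset.prod_mul_distrib, Finset.prod_pow_eq_pow_sum, Finset.prod_inv_distrib]
  field_simp

/-- Reindexing by `δ = g u + β` and `α k = |u k|`. By `sum_g` the condition on |δ| is then the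
equation defining `indexSet`, and the indices with |β| > q drop out because the derivative of `Q`
vanishes. -/
theorem sum_mul_eval_twistTaylor {n d q N : ℕ} {P Q : MvPolynomial (Fin n) ℝ}
    (hP : P.IsHomogeneous d) (hQ : Q.IsHomogeneous q) (B : ℕ → ℝ) (x : Fin n → ℝ) :
    ∑ δ ∈ Delta n (d * N + q + n),
        (∏ i, B (δ i)) * MvPolynomial.eval x (twistTaylor P Q δ) =
      ∑ β ∈ betas n q, ∑ α ∈ indexSet d q N β, ∑ u ∈ V n α,
        (-1) ^ (∑ k, α k) / ((tupleFactorial α : ℝ) * (tupleFactorial β : ℝ)) *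
          (∏ i, B (g u i + β i)) * (Pau P α u x * MvPolynomial.eval x (partialDeriv β Q)) := by
  have h1 : ∀ δ ∈ Delta n (d * N + q + n),
      (∏ i, B (δ i)) * MvPolynomial.eval x (twistTaylor P Q δ) =
      ∑ β ∈ (Iic δ).filter (fun β => ∑ i, β i ≤ q),
        ∑ u ∈ weighted (fun p : PairIndex n d => p.2.1) (δ - β),
          (∏ i, B (δ i)) * (MvPolynomial.eval x (taylor Q β) *
            dividedPow (fun p => - MvPolynomial.eval x (taylor P p.2.1)) u) := by
    intro δ _
    rw [Finset.sum_filter_of_ne]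
    · have := twistTaylor_mul P Q 1 δ
      rw [mul_one] at this
      rw [this, map_sum, Finset.mul_sum]
      refine Finset.sum_congr rfl fun β _ => ?_
      rw [map_mul, eval_twistTaylor_one hP, Finset.mul_sum, Finset.mul_sum]
    · intro β _ hne
      by_contra hlt
      apply hne
      rw [taylor, (isHomogeneous_partialDeriv hQ β).2 (not_le.1 hlt)]
      simp
  rw [Finset.sum_congr rfl h1]
  simp only [Finset.sum_sigma']
  have hadd : ∀ {δ β : Fin n → ℕ} {u : PairIndex n d → ℕ}, β ≤ δ →
      u ∈ weighted (fun p : PairIndex n d => p.2.1) (δ - β) →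
      g (fun k γ => u ⟨k, γ⟩) + β = δ := by
    intro δ β u hβ hu
    rw [mem_weighted PairIndex.val_ne_zero] at hu
    rw [← sum_smul_eq_g]
    exact (congrArg (· + β) hu).trans (tsub_add_cancel_of_le hβ)
  refine Finset.sum_bij'
    (fun p _ => ⟨p.2.1, fun k => ∑ γ, p.2.2 ⟨k, γ⟩, fun k γ => p.2.2 ⟨k, γ⟩⟩)
    (fun p _ => ⟨g p.2.2 + p.1, p.1, fun r => p.2.2 r.1 r.2⟩) ?_ ?_ ?_ ?_ ?_
  · rintro ⟨δ, β, u⟩ h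
    simp only [Finset.mem_sigma, Finset.mem_filter, Finset.mem_Iic] at h ⊢
    obtain ⟨hδ, ⟨hβ, hq⟩, hu⟩ := h
    have hV : (fun k γ => u ⟨k, γ⟩ : Family n d) ∈ V n fun k => ∑ γ, u ⟨k, γ⟩ :=
      mem_V.2 fun _ => rfl
    refine ⟨mem_betas.2 hq, mem_indexSet.2 ?_, hV⟩
    rw [← sum_g hV, ← Finset.sum_add_distrib, ← mem_Delta.1 hδ]
    exact Finset.sum_congr rfl fun i _ => congrFun (hadd hβ hu) i
  · rintro ⟨β, α, u⟩ h
    simp only [Finset.mem_sigma, Finset.mem_filter, Finset.mem_Iic] at h ⊢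
    obtain ⟨hβ, hα, hu⟩ := h
    refine ⟨mem_Delta.2 ?_, ⟨le_add_of_nonneg_left (by simp), mem_betas.1 hβ⟩, ?_⟩
    · rw [← mem_indexSet.1 hα, ← sum_g hu, ← Finset.sum_add_distrib]
      rfl
    · rw [mem_weighted PairIndex.val_ne_zero, sum_smul_eq_g, add_tsub_cancel_right]
  · rintro ⟨δ, β, u⟩ h
    simp only [Finset.mem_sigma, Finset.mem_filter, Finset.mem_Iic] at h
    obtain ⟨hδ, ⟨hβ, hq⟩, hu⟩ := h
    simp only [hadd hβ hu]
  · rintro ⟨β, α, u⟩ h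
    simp only [Finset.mem_sigma] at h
    obtain ⟨hβ, hα, hu⟩ := h
    simp only [mem_V.1 hu]
  · rintro ⟨δ, β, u⟩ h
    simp only [Finset.mem_sigma, Finset.mem_filter, Finset.mem_Iic] at h
    obtain ⟨hδ, ⟨hβ, hq⟩, hu⟩ := h
    have hV : (fun k γ => u ⟨k, γ⟩ : Family n d) ∈ V n fun k => ∑ γ, u ⟨k, γ⟩ :=
      mem_V.2 fun _ => rfl
    have h2 := dividedPow_eq_Pau P x hV
    have h3 := hadd hβ hu
    have h4 : ∏ i, B (g (fun k γ => u ⟨k, γ⟩ : Family n d) i + β i) = ∏ i, B (δ i) :=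
      Finset.prod_congr rfl fun i _ => congrArg B (congrFun h3 i)
    simp only at h2 ⊢
    rw [h4, h2, taylor, MvPolynomial.smul_eval]
    have := tupleFactorial_ne_zero β
    field_simp

end MahlerSeries

/-! ### One-variable Euler–Maclaurin formula on a cell and on the half-line. -/

namespace MahlerSeries

open Finset MeasureTheory Set Filter Topology
open scoped Nat

/-- The coefficients of `X / (1 - e^{-X})`. -/
noncomputable def toddCoeff (k : ℕ) : ℝ := (bernoulli' k : ℝ) / k !

theorem bernoulliFun_at_one (k : ℕ) : bernoulliFun k 1 = bernoulli' k := by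
  rw [bernoulliFun, Polynomial.eval_one_map, Polynomial.bernoulli_eval_one]
  simp

theorem hasDerivAt_bernoulliKernel (k : ℕ) (x : ℝ) :
    HasDerivAt (fun x => bernoulliFun (k + 1) (1 - x) / (k + 1)!)
      (-(bernoulliFun k (1 - x) / k !)) x := by
  have h1 : HasDerivAt (fun x : ℝ => 1 - x) (-1) x := by
    simpa using (hasDerivAt_id x).const_sub 1
  have h2 := ((hasDerivAt_bernoulliFun (k + 1) (1 - x)).comp x h1).div_const ((k + 1)! : ℝ)
  refine HasDerivAt.congr_deriv h2 ?_
  rw [Nat.factorial_succ]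
  push_cast
  have h3 : (k : ℝ) + 1 ≠ 0 := by positivity
  have h4 : (k ! : ℝ) ≠ 0 := by positivity
  field_simp

theorem continuous_bernoulliKernel (k : ℕ) :
    Continuous fun x : ℝ => bernoulliFun k (1 - x) / k ! := by
  unfold bernoulliFun
  fun_prop

theorem integral_bernoulliKernel_mul (k : ℕ) {f f' : ℝ → ℝ} (hf : ∀ x, HasDerivAt f (f' x) x)
    (hf' : Continuous f') :
    ∫ x in (0 : ℝ)..1, bernoulliFun (k + 1) (1 - x) / (k + 1)! * f' x =
      bernoulliFun (k + 1) 0 / (k + 1)! * f 1 - bernoulliFun (k + 1) 1 / (k + 1)! * f 0 +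
        ∫ x in (0 : ℝ)..1, bernoulliFun k (1 - x) / k ! * f x := by
  have hfc : Continuous f := continuous_iff_continuousAt.2 fun x => (hf x).continuousAt
  rw [intervalIntegral.integral_mul_deriv_eq_deriv_mul
    (fun x _ => hasDerivAt_bernoulliKernel k x) (fun x _ => hf x)
    ((continuous_bernoulliKernel k).neg.intervalIntegrable _ _)
    (hf'.intervalIntegrable _ _)]
  simp

/-- Repeated integration by parts against Bernoulli polynomials. Boundary differences are written as
integrals of the next derivative, so all terms are additive over adjacent cells and later integrate
over the other coordinates. -/
theorem eulerMaclaurin_unit {F : ℕ → ℝ → ℝ} (hF : ∀ k x, HasDerivAt (F k) (F (k + 1) x) x)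
    (M : ℕ) :
    F 0 1 = ∑ k ∈ Finset.range (M + 2), toddCoeff k * (∫ x in (0 : ℝ)..1, F k x) -
      ∫ x in (0 : ℝ)..1, bernoulliFun (M + 1) (1 - x) / (M + 1)! * F (M + 1) x := by
  have hc : ∀ k, Continuous (F k) := fun k =>
    continuous_iff_continuousAt.2 fun x => (hF k x).continuousAt
  have hint : ∀ k, ∫ x in (0 : ℝ)..1, F (k + 1) x = F k 1 - F k 0 := fun k =>
    intervalIntegral.integral_eq_sub_of_hasDerivAt (fun x _ => hF k x)
      ((hc _).intervalIntegrable _ _)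
  induction M with
  | zero =>
    rw [integral_bernoulliKernel_mul 0 (hF 0) (hc 1)]
    simp only [Finset.sum_range_succ, Finset.sum_range_zero, hint]
    simp [toddCoeff, bernoulliFun_at_one, bernoulliFun_eval_zero]
    ring
  | succ M ih =>
    rw [integral_bernoulliKernel_mul (M + 1) (hF (M + 1)) (hc _), Finset.sum_range_succ, hint]
    -- From index 2 on the Bernoulli polynomial has equal endpoint values, so the boundary terms
    -- combine into a multiple of an integral; index 1 was the base case.
    rw [← bernoulliFun_endpoints_eq_of_ne_one (k := M + 1 + 1) (by omega), bernoulliFun_at_one]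
    conv_lhs => rw [ih]
    rw [toddCoeff]
    ring

/-- Rescaling from the unit interval. The constant is a bound for the Bernoulli kernel on `[0, 1]`,
hence independent of `F`, `h` and `a`; this uniformity permits summing over cells and integrating
over slices. -/
theorem exists_eulerMaclaurin_bound (M : ℕ) : ∃ C : ℝ, 0 ≤ C ∧
    ∀ {F : ℕ → ℝ → ℝ}, (∀ k x, HasDerivAt (F k) (F (k + 1) x) x) → ∀ {h : ℝ}, 0 < h → ∀ a : ℝ,
      |h * F 0 (a + h) - ∑ k ∈ Finset.range (M + 2),
        toddCoeff k * h ^ k * ∫ x in a..a + h, F k x| ≤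
      C * h ^ (M + 1) * ∫ x in a..a + h, |F (M + 1) x| := by
  obtain ⟨C, hC⟩ := isCompact_Icc.exists_bound_of_continuousOn (s := Set.Icc (0 : ℝ) 1)
    (continuous_bernoulliKernel (M + 1)).continuousOn
  have hC0 : 0 ≤ C := (norm_nonneg _).trans (hC 0 (by simp))
  refine ⟨C, hC0, ?_⟩
  intro F hF h hh a
  have hc : ∀ k, Continuous (F k) := fun k =>
    continuous_iff_continuousAt.2 fun x => (hF k x).continuousAt
  have hψ : ∀ k x, HasDerivAt (fun x => h ^ k * F k (a + h * x))
      (h ^ (k + 1) * F (k + 1) (a + h * x)) x := by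
    intro k x
    have h1 : HasDerivAt (fun x : ℝ => a + h * x) h x := by
      simpa using ((hasDerivAt_id x).const_mul h).const_add a
    refine HasDerivAt.congr_deriv (((hF k (a + h * x)).comp x h1).const_mul (h ^ k)) ?_
    ring
  have key := eulerMaclaurin_unit hψ M
  simp only [pow_zero, one_mul, mul_one, intervalIntegral.integral_const_mul] at key
  have hsub : ∀ f : ℝ → ℝ, h * ∫ x in (0 : ℝ)..1, f (a + h * x) = ∫ x in a..a + h, f x := by
    intro f
    have := intervalIntegral.smul_integral_comp_add_mul (a := 0) (b := 1) f h a
    simpa only [smul_eq_mul, mul_zero, mul_one, add_zero] using this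
  rw [key, mul_sub, Finset.mul_sum]
  have e1 : ∀ k ∈ Finset.range (M + 2), h * (toddCoeff k * (h ^ k * ∫ x in (0 : ℝ)..1,
      F k (a + h * x))) = toddCoeff k * h ^ k * ∫ x in a..a + h, F k x := by
    intro k _
    rw [← hsub]
    ring
  rw [Finset.sum_congr rfl e1, sub_sub_cancel_left, abs_neg, abs_mul, abs_of_pos hh,
    ← hsub (fun x => |F (M + 1) x|), mul_left_comm]
  refine mul_le_mul_of_nonneg_left ?_ hh.le
  rw [← intervalIntegral.integral_const_mul]
  refine (intervalIntegral.abs_integral_le_integral_abs zero_le_one).trans ?_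
  refine intervalIntegral.integral_mono_on zero_le_one ?_ ?_ ?_
  · refine Continuous.intervalIntegrable ?_ _ _
    have := continuous_bernoulliKernel (M + 1)
    have := hc (M + 1)
    fun_prop
  · refine Continuous.intervalIntegrable ?_ _ _
    have := hc (M + 1)
    fun_prop
  · intro x hx
    rw [abs_mul, abs_mul, abs_of_pos (pow_pos hh _), ← mul_assoc]
    exact mul_le_mul_of_nonneg_right (mul_le_mul_of_nonneg_right (hC x hx) (by positivity))
      (abs_nonneg _)

/-- The smallest multiple of `h` by a natural number that is at least `x`. -/
noncomputable def roundUp (h x : ℝ) : ℝ := h * (⌈x / h⌉₊ : ℝ)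

theorem measurable_roundUp (h : ℝ) : Measurable (roundUp h) := by
  unfold roundUp
  fun_prop

theorem le_roundUp {h : ℝ} (hh : 0 < h) (x : ℝ) : x ≤ roundUp h x := by
  unfold roundUp
  have := Nat.le_ceil (x / h)
  rw [div_le_iff₀ hh] at this
  linarith

theorem roundUp_eq {h : ℝ} (hh : 0 < h) (j : ℕ) {x : ℝ} (hx : x ∈ Set.Ioc (h * j) (h * j + h)) :
    roundUp h x = h * j + h := by
  have : ⌈x / h⌉₊ = j + 1 := by
    rw [Nat.ceil_eq_iff (by omega)]
    constructor
    · rw [lt_div_iff₀ hh]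
      push_cast
      linarith [hx.1]
    · rw [div_le_iff₀ hh]
      push_cast
      linarith [hx.2]
  rw [roundUp, this]
  push_cast
  ring

/-- The integral of the step function `F 0 ∘ roundUp h` is the Riemann sum with right endpoints.
Cell errors add up to at most the integral of the last derivative's absolute value. -/
theorem exists_eulerMaclaurin_Ioi_bound (M : ℕ) : ∃ C : ℝ, 0 ≤ C ∧
    ∀ {F : ℕ → ℝ → ℝ}, (∀ k x, HasDerivAt (F k) (F (k + 1) x) x) →
      (∀ k, IntegrableOn (F k) (Set.Ioi 0)) → ∀ {h : ℝ}, 0 < h →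
      IntegrableOn (fun x => F 0 (roundUp h x)) (Set.Ioi 0) →
      |(∫ x in Set.Ioi 0, F 0 (roundUp h x)) - ∑ k ∈ Finset.range (M + 2),
        toddCoeff k * h ^ k * ∫ x in Set.Ioi 0, F k x| ≤
      C * h ^ (M + 1) * ∫ x in Set.Ioi 0, |F (M + 1) x| := by
  obtain ⟨C, hC0, hC⟩ := exists_eulerMaclaurin_bound M
  refine ⟨C, hC0, ?_⟩
  intro F hF hi h hh hi0
  -- Sum and main terms are merged into one integrand, so that a single limit of the integrals over
  -- `(0, h m]` suffices.
  set Ψ : ℝ → ℝ := fun x => F 0 (roundUp h x) -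
    ∑ k ∈ Finset.range (M + 2), toddCoeff k * h ^ k * F k x with hΨ
  have hsumi : ∀ s ⊆ Set.Ioi (0 : ℝ), IntegrableOn (fun x =>
      ∑ k ∈ Finset.range (M + 2), toddCoeff k * h ^ k * F k x) s := fun s hs =>
    integrable_finsetSum _ fun k _ => ((hi k).mono_set hs).const_mul _
  have hΨi : IntegrableOn Ψ (Set.Ioi 0) := hi0.sub (hsumi _ subset_rfl)
  have hΨint : ∫ x in Set.Ioi 0, Ψ x = (∫ x in Set.Ioi 0, F 0 (roundUp h x)) -
      ∑ k ∈ Finset.range (M + 2), toddCoeff k * h ^ k * ∫ x in Set.Ioi 0, F k x := by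
    rw [hΨ, integral_sub hi0 (hsumi _ subset_rfl),
      integral_finsetSum _ fun k _ => (hi k).const_mul _]
    simp only [integral_const_mul]
  have hsub : ∀ j : ℕ, Set.Ioc (h * j) (h * j + h) ⊆ Set.Ioi 0 := fun j x hx =>
    lt_of_le_of_lt (by positivity) hx.1
  have hii : ∀ {f : ℝ → ℝ}, IntegrableOn f (Set.Ioi 0) → ∀ j : ℕ,
      IntervalIntegrable f volume (h * j) (h * j + h) := fun hf j =>
    (intervalIntegrable_iff_integrableOn_Ioc_of_le (by linarith)).2 (hf.mono_set (hsub j))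
  have hcell : ∀ j : ℕ, |∫ x in (h * j)..(h * j + h), Ψ x| ≤
      C * h ^ (M + 1) * ∫ x in (h * j)..(h * j + h), |F (M + 1) x| := by
    intro j
    refine le_trans (le_of_eq ?_) (hC hF hh (h * j))
    congr 1
    rw [hΨ, intervalIntegral.integral_sub (hii hi0 j) (hii (hsumi _ subset_rfl) j),
      intervalIntegral.integral_finsetSum fun k _ => (hii (hi k) j).const_mul _]
    simp only [intervalIntegral.integral_const_mul]
    congr 1
    rw [intervalIntegral.integral_of_le (by linarith),
      setIntegral_congr_fun measurableSet_Ioc fun x hx => by rw [roundUp_eq hh j hx]]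
    simp [hh.le]
  have hadd : ∀ {f : ℝ → ℝ}, IntegrableOn f (Set.Ioi 0) → ∀ m : ℕ,
      ∫ x in (0 : ℝ)..(h * m), f x =
        ∑ j ∈ Finset.range m, ∫ x in (h * j)..(h * j + h), f x := by
    intro f hf m
    have := intervalIntegral.sum_integral_adjacent_intervals (f := f) (μ := volume)
      (a := fun j : ℕ => h * j) (n := m) (fun k _ => by
        simpa [mul_add] using hii hf k)
    simpa [mul_add] using this.symm
  have hpart : ∀ m : ℕ, |∫ x in (0 : ℝ)..(h * m), Ψ x| ≤
      C * h ^ (M + 1) * ∫ x in Set.Ioi 0, |F (M + 1) x| := by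
    intro m
    rw [hadd hΨi m]
    refine (Finset.abs_sum_le_sum_abs _ _).trans
      ((Finset.sum_le_sum fun j _ => hcell j).trans ?_)
    have habs : IntegrableOn (fun x => |F (M + 1) x|) (Set.Ioi 0) := (hi (M + 1)).norm
    rw [← Finset.mul_sum, ← hadd habs]
    refine mul_le_mul_of_nonneg_left ?_ (by positivity)
    rw [intervalIntegral.integral_of_le (by positivity)]
    exact setIntegral_mono_set habs (Eventually.of_forall fun _ => abs_nonneg _)
      (Eventually.of_forall fun x hx => hx.1)
  have hlim : Tendsto (fun m : ℕ => |∫ x in (0 : ℝ)..(h * m), Ψ x|) atTop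
      (𝓝 |∫ x in Set.Ioi 0, Ψ x|) :=
    (intervalIntegral_tendsto_integral_Ioi 0 hΨi
      (tendsto_natCast_atTop_atTop.const_mul_atTop hh)).abs
  rw [← hΨint]
  exact le_of_tendsto' hlim hpart

end MahlerSeries

/-! ### Growth bounds for elliptic polynomials and decay of G exp(-P) on the orthant. -/

namespace MahlerSeries

open Finset MeasureTheory Set Filter Topology
open scoped Nat

theorem eval_smul_of_isHomogeneous {n m : ℕ} {G : MvPolynomial (Fin n) ℝ}
    (hG : G.IsHomogeneous m) (r : ℝ) (x : Fin n → ℝ) :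
    MvPolynomial.eval (r • x) G = r ^ m * MvPolynomial.eval x G := by
  rw [MvPolynomial.eval_eq, MvPolynomial.eval_eq, Finset.mul_sum]
  refine Finset.sum_congr rfl fun s hs => ?_
  have h1 : s.degree = m := by
    rw [← hG (MvPolynomial.mem_support_iff.1 hs), Finsupp.degree_eq_weight_one]
    rfl
  have h2 : ∏ i ∈ s.support, (r • x) i ^ s i = r ^ m * ∏ i ∈ s.support, x i ^ s i := by
    rw [← h1, Finsupp.degree_apply, ← Finset.prod_pow_eq_pow_sum, ← Finset.prod_mul_distrib]
    exact Finset.prod_congr rfl fun i _ => mul_pow _ _ _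
  rw [h2]
  ring

theorem IsElliptic.eval_pos {n d : ℕ} {P : MvPolynomial (Fin n) ℝ} (hP : IsElliptic P)
    (hd : P.IsHomogeneous d) {x : Fin n → ℝ} (hx : ∀ i, 0 ≤ x i) (hx0 : x ≠ 0) :
    0 < MvPolynomial.eval x P := by
  have h := hP x hx hx0
  by_cases hP0 : P = 0
  · simp [hP0] at h
  · rwa [hd.totalDegree hP0, MvPolynomial.homogeneousComponent_of_mem hd, if_pos rfl] at h

theorem isCompact_nonneg_sphere (n : ℕ) :
    IsCompact {x : Fin n → ℝ | (∀ i, 0 ≤ x i) ∧ ‖x‖ = 1} := by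
  have h1 : {x : Fin n → ℝ | (∀ i, 0 ≤ x i) ∧ ‖x‖ = 1} =
      Metric.sphere 0 1 ∩ ⋂ i, {x : Fin n → ℝ | 0 ≤ x i} := by
    ext x
    simp [and_comm]
  rw [h1]
  exact (isCompact_sphere _ _).inter_right
    (isClosed_iInter fun i => isClosed_le continuous_const (continuous_apply i))

theorem exists_mem_nonneg_sphere {n : ℕ} {x : Fin n → ℝ} (hx : ∀ i, 0 ≤ x i) (hx0 : x ≠ 0) :
    ∃ y ∈ {y : Fin n → ℝ | (∀ i, 0 ≤ y i) ∧ ‖y‖ = 1}, x = ‖x‖ • y := by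
  have h : ‖x‖ ≠ 0 := norm_ne_zero_iff.2 hx0
  refine ⟨‖x‖⁻¹ • x, ⟨fun i => ?_, ?_⟩, ?_⟩
  · exact mul_nonneg (inv_nonneg.2 (norm_nonneg _)) (hx i)
  · rw [norm_smul, norm_inv, norm_norm, inv_mul_cancel₀ h]
  · rw [smul_smul, mul_inv_cancel₀ h, one_smul]

/-- `P` is bounded below by a positive constant on the compact nonnegative part of the unit sphere;
homogeneity spreads this bound along rays. -/
theorem IsElliptic.exists_le_eval {n d : ℕ} {P : MvPolynomial (Fin n) ℝ} (hP : IsElliptic P)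
    (hPd : P.IsHomogeneous d) (hd : 1 ≤ d) :
    ∃ c : ℝ, 0 < c ∧ ∀ x : Fin n → ℝ, (∀ i, 0 ≤ x i) →
      c * ‖x‖ ^ d ≤ MvPolynomial.eval x P := by
  obtain ⟨c, hc0, hc⟩ := (isCompact_nonneg_sphere n).exists_forall_le'
    (f := fun x => MvPolynomial.eval x P) (MvPolynomial.continuous_eval P).continuousOn
    (a := 0) (fun x hx => hP.eval_pos hPd hx.1 fun h => by simp [h] at hx)
  refine ⟨c, hc0, fun x hx => ?_⟩
  by_cases hx0 : x = 0
  · have := eval_smul_of_isHomogeneous hPd 0 x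
    rw [zero_smul, zero_pow (by omega), zero_mul] at this
    rw [hx0, this, norm_zero, zero_pow (by omega), mul_zero]
  · obtain ⟨y, hy, hxy⟩ := exists_mem_nonneg_sphere hx hx0
    conv_rhs => rw [hxy]
    rw [eval_smul_of_isHomogeneous hPd, mul_comm]
    exact mul_le_mul_of_nonneg_left (hc y hy) (by positivity)

theorem exists_abs_eval_le_of_isHomogeneous {n q : ℕ} {Q : MvPolynomial (Fin n) ℝ}
    (hQ : Q.IsHomogeneous q) :
    ∃ C : ℝ, 0 ≤ C ∧ ∀ x : Fin n → ℝ, (∀ i, 0 ≤ x i) → x ≠ 0 →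
      |MvPolynomial.eval x Q| ≤ C * ‖x‖ ^ q := by
  obtain ⟨C, hC⟩ := (isCompact_nonneg_sphere n).exists_bound_of_continuousOn
    (MvPolynomial.continuous_eval Q).continuousOn
  refine ⟨max C 0, le_max_right _ _, fun x hx hx0 => ?_⟩
  obtain ⟨y, hy, hxy⟩ := exists_mem_nonneg_sphere hx hx0
  conv_lhs => rw [hxy]
  rw [eval_smul_of_isHomogeneous hQ, abs_mul, abs_pow, abs_norm, mul_comm]
  exact mul_le_mul_of_nonneg_right ((hC y hy).trans (le_max_left _ _)) (by positivity)

theorem exists_abs_eval_le {n : ℕ} (G : MvPolynomial (Fin n) ℝ) :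
    ∃ (C : ℝ) (D : ℕ), 0 ≤ C ∧ ∀ x : Fin n → ℝ,
      |MvPolynomial.eval x G| ≤ C * (1 + ‖x‖) ^ D := by
  induction G using MvPolynomial.induction_on with
  | C a => exact ⟨|a|, 0, abs_nonneg _, fun x => by simp⟩
  | add p q hp hq =>
    obtain ⟨C₁, D₁, h₁, H₁⟩ := hp
    obtain ⟨C₂, D₂, h₂, H₂⟩ := hq
    refine ⟨C₁ + C₂, D₁ + D₂, add_nonneg h₁ h₂, fun x => ?_⟩
    have hx : 1 ≤ 1 + ‖x‖ := le_add_of_nonneg_right (norm_nonneg _)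
    rw [map_add, add_mul]
    refine (abs_add_le _ _).trans (add_le_add ((H₁ x).trans ?_) ((H₂ x).trans ?_))
    · exact mul_le_mul_of_nonneg_left (pow_le_pow_right₀ hx (Nat.le_add_right _ _)) h₁
    · exact mul_le_mul_of_nonneg_left (pow_le_pow_right₀ hx (Nat.le_add_left _ _)) h₂
  | mul_X p i hp =>
    obtain ⟨C, D, h, H⟩ := hp
    refine ⟨C, D + 1, h, fun x => ?_⟩
    rw [map_mul, MvPolynomial.eval_X, abs_mul, pow_succ, ← mul_assoc]
    refine mul_le_mul (H x) ?_ (abs_nonneg _) (by positivity)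
    exact (norm_le_pi_norm x i).trans (by linarith)

/-- The function `G(x) exp (-P(x))`. -/
noncomputable def expPoly {n : ℕ} (P G : MvPolynomial (Fin n) ℝ) (x : Fin n → ℝ) : ℝ :=
  MvPolynomial.eval x G * Real.exp (-MvPolynomial.eval x P)

theorem continuous_expPoly {n : ℕ} (P G : MvPolynomial (Fin n) ℝ) : Continuous (expPoly P G) := by
  unfold expPoly
  have h1 := MvPolynomial.continuous_eval G
  have h2 := MvPolynomial.continuous_eval P
  fun_prop

/-- A positive function that is integrable on the orthant and decreasing in each coordinate. -/
noncomputable def majorant {n : ℕ} (x : Fin n → ℝ) : ℝ := ∏ i, ((1 + x i) ^ 2)⁻¹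

theorem majorant_anti {n : ℕ} {x y : Fin n → ℝ} (hx : ∀ i, 0 ≤ x i) (h : ∀ i, x i ≤ y i) :
    majorant y ≤ majorant x := by
  refine Finset.prod_le_prod (fun i _ => by positivity) fun i _ => ?_
  have h1 := hx i
  have h2 := h i
  exact inv_anti₀ (by positivity) (by gcongr)

theorem IsElliptic.exists_abs_expPoly_le {n d : ℕ} {P : MvPolynomial (Fin n) ℝ}
    (hP : IsElliptic P) (hPd : P.IsHomogeneous d) (hd : 1 ≤ d) (G : MvPolynomial (Fin n) ℝ) :
    ∃ C : ℝ, 0 ≤ C ∧ ∀ x : Fin n → ℝ, (∀ i, 0 ≤ x i) → |expPoly P G x| ≤ C * majorant x := by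
  obtain ⟨c, hc0, hc⟩ := hP.exists_le_eval hPd hd
  obtain ⟨C, D, hC0, hC⟩ := exists_abs_eval_le G
  -- The growth degree of `G` plus the degree of the reciprocal of the majorant.
  set K := D + 2 * n with hK
  refine ⟨C * ((K ! : ℝ) / c ^ K * Real.exp (2 * c)), by positivity, fun x hx => ?_⟩
  set r := ‖x‖ with hr
  have hr0 : 0 ≤ r := norm_nonneg _
  have hprod : ∏ i, (1 + x i) ^ 2 ≤ (1 + r) ^ (2 * n) := by
    calc ∏ i, (1 + x i) ^ 2 ≤ ∏ _i : Fin n, (1 + r) ^ 2 := by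
          refine Finset.prod_le_prod (fun i _ => by positivity) fun i _ => ?_
          have h1 := hx i
          have h2 : x i ≤ r := (le_abs_self _).trans (norm_le_pi_norm x i)
          gcongr
      _ = (1 + r) ^ (2 * n) := by simp [pow_mul]
  have hpos : 0 < ∏ i, (1 + x i) ^ 2 := Finset.prod_pos fun i _ => by
    have := hx i
    positivity
  have hmaj : majorant x = (∏ i, (1 + x i) ^ 2)⁻¹ := Finset.prod_inv_distrib ..
  rw [hmaj, ← div_eq_mul_inv, le_div_iff₀ hpos, expPoly, abs_mul, Real.abs_exp]
  -- This replaces the exponent `r ^ d` by a linear one, at the price of the factor `exp (2 * c)`,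
  -- since `r - 1 = (1 + r) - 2`.
  have hrd : r - 1 ≤ r ^ d := by
    rcases le_total 1 r with h | h
    · linarith [le_self_pow₀ h (show d ≠ 0 by omega)]
    · linarith [pow_nonneg hr0 d]
  have hexp : Real.exp (-MvPolynomial.eval x P) ≤ Real.exp (2 * c) * Real.exp (-(c * (1 + r))) := by
    rw [← Real.exp_add, Real.exp_le_exp]
    have h1 := hc x hx
    have h2 := mul_le_mul_of_nonneg_left hrd hc0.le
    linarith
  have hpow : (1 + r) ^ K * Real.exp (-(c * (1 + r))) ≤ (K ! : ℝ) / c ^ K := by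
    have h1 := Real.pow_div_factorial_le_exp (c * (1 + r)) (by positivity) K
    rw [Real.exp_neg, ← div_eq_mul_inv, div_le_div_iff₀ (Real.exp_pos _) (by positivity)]
    rw [div_le_iff₀ (by positivity), mul_pow] at h1
    linarith
  calc |MvPolynomial.eval x G| * Real.exp (-MvPolynomial.eval x P) * ∏ i, (1 + x i) ^ 2
      ≤ (C * (1 + r) ^ D) * (Real.exp (2 * c) * Real.exp (-(c * (1 + r)))) *
          (1 + r) ^ (2 * n) := by
        refine mul_le_mul (mul_le_mul (hC x) hexp (by positivity) (by positivity)) hprod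
          hpos.le (by positivity)
    _ = C * (((1 + r) ^ K * Real.exp (-(c * (1 + r)))) * Real.exp (2 * c)) := by
        rw [hK, pow_add]
        ring
    _ ≤ C * ((K ! : ℝ) / c ^ K * Real.exp (2 * c)) := by gcongr

theorem hasDerivAt_eval_update {n : ℕ} (p : MvPolynomial (Fin n) ℝ) (i : Fin n) (z : Fin n → ℝ)
    (t : ℝ) :
    HasDerivAt (fun t => MvPolynomial.eval (Function.update z i t) p)
      (MvPolynomial.eval (Function.update z i t) (MvPolynomial.pderiv i p)) t := by
  induction p using MvPolynomial.induction_on with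
  | C a => simpa using hasDerivAt_const t a
  | add p q hp hq =>
    simp only [map_add]
    exact hp.add hq
  | mul_X p j hp =>
    have hj : HasDerivAt (fun t => Function.update z i t j)
        (MvPolynomial.eval (Function.update z i t) (MvPolynomial.pderiv i (MvPolynomial.X j))) t := by
      by_cases h : j = i
      · subst h
        simpa using hasDerivAt_id' t
      · simpa [MvPolynomial.pderiv_X, Pi.single_apply, Function.update_of_ne h, h] using
          hasDerivAt_const t (z j)
    have := hp.mul hj
    simp only [map_mul, MvPolynomial.eval_X]
    refine HasDerivAt.congr_deriv this ?_
    rw [MvPolynomial.pderiv_mul]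
    simp

/-- Differentiation stays inside the class of polynomials times exp(-P), so the decay bound covers
all derivatives at once. -/
theorem hasDerivAt_expPoly_update {n : ℕ} (P G : MvPolynomial (Fin n) ℝ) (i : Fin n)
    (z : Fin n → ℝ) (t : ℝ) :
    HasDerivAt (fun t => expPoly P G (Function.update z i t))
      (expPoly P (twist P i G) (Function.update z i t)) t := by
  have h := (hasDerivAt_eval_update G i z t).mul (hasDerivAt_eval_update P i z t).neg.exp
  refine HasDerivAt.congr_deriv h ?_
  simp only [expPoly, twist, map_sub, map_mul, Pi.neg_apply]
  ring

/-- Lebesgue measure on the orthant `(0, ∞)^n`. -/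
noncomputable def orthant (n : ℕ) : Measure (Fin n → ℝ) :=
  Measure.pi fun _ => (volume : Measure ℝ).restrict (Set.Ioi 0)

theorem orthant_eq_restrict (n : ℕ) :
    orthant n = (volume : Measure (Fin n → ℝ)).restrict (Set.univ.pi fun _ => Set.Ioi 0) := by
  rw [orthant, volume_pi, Measure.restrict_pi_pi]

theorem ae_orthant_pos (n : ℕ) : ∀ᵐ x ∂(orthant n), ∀ i, 0 < x i := by
  rw [orthant_eq_restrict]
  filter_upwards [ae_restrict_mem (MeasurableSet.univ_pi fun _ => measurableSet_Ioi)] with x hx i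
  exact hx i (Set.mem_univ i)

instance sigmaFinite_orthant (n : ℕ) : SigmaFinite (orthant n) := by
  unfold orthant
  infer_instance

theorem integrableOn_inv_sq : IntegrableOn (fun t : ℝ => ((1 + t) ^ 2)⁻¹) (Set.Ioi 0) := by
  have := integrableOn_add_rpow_Ioi_of_lt (a := -2) (c := 0) (m := 1) (by norm_num) (by norm_num)
  refine this.congr_fun (fun t ht => ?_) measurableSet_Ioi
  have ht' : (0 : ℝ) < t := ht
  simp only
  rw [Real.rpow_neg (by linarith), add_comm]
  norm_num

theorem integrable_majorant (n : ℕ) : Integrable (majorant : (Fin n → ℝ) → ℝ) (orthant n) :=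
  Integrable.fintype_prod (f := fun _ t => ((1 + t) ^ 2)⁻¹) fun _ => integrableOn_inv_sq

end MahlerSeries

/-! ### Euler–Maclaurin in one coordinate of the orthant. -/

namespace MahlerSeries

open Finset MeasureTheory Set Filter Topology
open scoped Nat

/-- Round the coordinates outside `σ` up to multiples of `h`. -/
noncomputable def mixRound {n : ℕ} (h : ℝ) (σ : Finset (Fin n)) (x : Fin n → ℝ) : Fin n → ℝ :=
  fun j => if j ∈ σ then x j else roundUp h (x j)

theorem measurable_mixRound {n : ℕ} (h : ℝ) (σ : Finset (Fin n)) :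
    Measurable (mixRound h σ) := by
  refine measurable_pi_lambda _ fun j => ?_
  unfold mixRound
  by_cases hj : j ∈ σ
  · simpa [hj] using measurable_pi_apply j
  · simp only [hj, if_false]
    exact (measurable_roundUp h).comp (measurable_pi_apply j)

theorem le_mixRound {n : ℕ} {h : ℝ} (hh : 0 < h) (σ : Finset (Fin n)) (x : Fin n → ℝ)
    (j : Fin n) : x j ≤ mixRound h σ x j := by
  unfold mixRound
  split_ifs
  · exact le_rfl
  · exact le_roundUp hh _

theorem mixRound_univ {n : ℕ} (h : ℝ) (x : Fin n → ℝ) : mixRound h Finset.univ x = x := by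
  ext j
  simp [mixRound]

/-- With the next lemma: before and after releasing coordinate `i` from rounding, a slice runs along
the same line, so the one-variable formula compares the two. -/
theorem mixRound_insertNth {n : ℕ} (h : ℝ) {σ : Finset (Fin (n + 1))} {i : Fin (n + 1)}
    (hi : i ∉ σ) (t : ℝ) (x : Fin n → ℝ) :
    mixRound h σ (i.insertNth t x) =
      Function.update (mixRound h σ (i.insertNth 0 x)) i (roundUp h t) := by
  ext j
  refine Fin.succAboveCases i ?_ (fun j => ?_) j
  · simp [mixRound, hi]
  · simp [mixRound]

theorem mixRound_insert_insertNth {n : ℕ} (h : ℝ) {σ : Finset (Fin (n + 1))} {i : Fin (n + 1)}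
    (t : ℝ) (x : Fin n → ℝ) :
    mixRound h (insert i σ) (i.insertNth t x) =
      Function.update (mixRound h σ (i.insertNth 0 x)) i t := by
  ext j
  refine Fin.succAboveCases i ?_ (fun j => ?_) j
  · simp [mixRound]
  · simp [mixRound, Fin.succAbove_ne i j]

theorem majorant_insertNth {n : ℕ} (i : Fin (n + 1)) (t : ℝ) (x : Fin n → ℝ) :
    majorant (i.insertNth t x : Fin (n + 1) → ℝ) = ((1 + t) ^ 2)⁻¹ * majorant x := by
  simp [majorant, Fin.prod_univ_succAbove _ i]

/-- The integral of `G exp (-P)` with the coordinates outside `σ` rounded up. -/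
noncomputable def mixIntegral {n : ℕ} (P : MvPolynomial (Fin n) ℝ) (h : ℝ) (σ : Finset (Fin n))
    (G : MvPolynomial (Fin n) ℝ) : ℝ :=
  ∫ x, expPoly P G (mixRound h σ x) ∂(orthant n)

/-- Rounding only increases coordinates and the majorant decreases in each of them, so one bound
serves for all `h` and `σ`. -/
theorem ae_abs_expPoly_mixRound_le {n : ℕ} {P G : MvPolynomial (Fin n) ℝ} {C : ℝ} (hC0 : 0 ≤ C)
    (hC : ∀ x : Fin n → ℝ, (∀ i, 0 ≤ x i) → |expPoly P G x| ≤ C * majorant x)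
    {h : ℝ} (hh : 0 < h) (σ : Finset (Fin n)) :
    ∀ᵐ x ∂(orthant n), ‖expPoly P G (mixRound h σ x)‖ ≤ C * majorant x := by
  filter_upwards [ae_orthant_pos n] with x hx
  refine (hC _ fun i => (hx i).le.trans (le_mixRound hh σ x i)).trans ?_
  exact mul_le_mul_of_nonneg_left (majorant_anti (fun i => (hx i).le) (le_mixRound hh σ x)) hC0

theorem integrable_expPoly_mixRound {n : ℕ} {P G : MvPolynomial (Fin n) ℝ} {C : ℝ} (hC0 : 0 ≤ C)
    (hC : ∀ x : Fin n → ℝ, (∀ i, 0 ≤ x i) → |expPoly P G x| ≤ C * majorant x)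
    {h : ℝ} (hh : 0 < h) (σ : Finset (Fin n)) :
    Integrable (fun x => expPoly P G (mixRound h σ x)) (orthant n) :=
  ((integrable_majorant n).const_mul C).mono'
    ((continuous_expPoly P G).measurable.comp (measurable_mixRound h σ)).aestronglyMeasurable
    (ae_abs_expPoly_mixRound_le hC0 hC hh σ)

theorem measurePreserving_insertNth (n : ℕ) (i : Fin (n + 1)) :
    MeasurePreserving (MeasurableEquiv.piFinSuccAbove (fun _ : Fin (n + 1) => ℝ) i).symm
      (((volume : Measure ℝ).restrict (Set.Ioi 0)).prod (orthant n)) (orthant (n + 1)) :=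
  (measurePreserving_piFinSuccAbove (fun _ : Fin (n + 1) =>
    (volume : Measure ℝ).restrict (Set.Ioi 0)) i).symm

theorem integral_orthant_succ {n : ℕ} (i : Fin (n + 1)) {f : (Fin (n + 1) → ℝ) → ℝ}
    (hf : Integrable f (orthant (n + 1))) :
    Integrable (fun x : Fin n → ℝ => ∫ t in Set.Ioi 0, f (i.insertNth t x)) (orthant n) ∧
    ∫ x, f x ∂(orthant (n + 1)) =
      ∫ x, (∫ t in Set.Ioi 0, f (i.insertNth t x)) ∂(orthant n) := by
  have h1 := (measurePreserving_insertNth n i).integrable_comp_of_integrable hf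
  refine ⟨h1.integral_prod_right, ?_⟩
  rw [← (measurePreserving_insertNth n i).integral_comp']
  exact integral_prod_symm _ h1

/-- The half-line formula is applied to almost every slice in direction `i` and integrated by
Fubini. -/
theorem exists_mixIntegral_step {n d : ℕ} {P : MvPolynomial (Fin n) ℝ} (hP : IsElliptic P)
    (hPd : P.IsHomogeneous d) (hd : 1 ≤ d) (G : MvPolynomial (Fin n) ℝ) (M : ℕ) (i : Fin n) :
    ∃ C : ℝ, ∀ σ : Finset (Fin n), i ∉ σ → ∀ h : ℝ, 0 < h →
      |mixIntegral P h σ G - ∑ k ∈ Finset.range (M + 2),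
        toddCoeff k * h ^ k * mixIntegral P h (insert i σ) ((twist P i)^[k] G)| ≤
      C * h ^ (M + 1) := by
  obtain ⟨m, rfl⟩ : ∃ m, n = m + 1 := ⟨n - 1, by have := i.pos; omega⟩
  obtain ⟨C₁, hC₁0, hC₁⟩ := exists_eulerMaclaurin_Ioi_bound M
  choose A hA0 hA using hP.exists_abs_expPoly_le hPd hd
  set κ : ℝ := ∫ t in Set.Ioi (0 : ℝ), ((1 + t) ^ 2)⁻¹ with hκ
  have hint : ∀ G, ∀ h : ℝ, 0 < h → ∀ σ, Integrable (fun x => expPoly P G (mixRound h σ x))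
      (orthant (m + 1)) := fun G h hh σ => integrable_expPoly_mixRound (hA0 G) (hA G) hh σ
  -- The factors are the Euler–Maclaurin constant, the decay constant of the last derivative, the
  -- integral of the majorant along coordinate `i` and its integral over the others.
  refine ⟨C₁ * (A ((twist P i)^[M + 1] G) * κ) * ∫ x, majorant x ∂(orthant m), ?_⟩
  intro σ hi h hh
  obtain ⟨i0, e0⟩ := integral_orthant_succ i (hint G h hh σ)
  have ek : ∀ k, Integrable (fun x : Fin m → ℝ => ∫ t in Set.Ioi 0,
      expPoly P ((twist P i)^[k] G) (mixRound h (insert i σ) (i.insertNth t x))) (orthant m) ∧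
      mixIntegral P h (insert i σ) ((twist P i)^[k] G) = ∫ x, (∫ t in Set.Ioi 0,
        expPoly P ((twist P i)^[k] G) (mixRound h (insert i σ) (i.insertNth t x)))
          ∂(orthant m) := fun k => integral_orthant_succ i (hint _ h hh _)
  have hsum : mixIntegral P h σ G - ∑ k ∈ Finset.range (M + 2),
        toddCoeff k * h ^ k * mixIntegral P h (insert i σ) ((twist P i)^[k] G) =
      ∫ x, ((∫ t in Set.Ioi 0, expPoly P G (mixRound h σ (i.insertNth t x))) -
        ∑ k ∈ Finset.range (M + 2), toddCoeff k * h ^ k * ∫ t in Set.Ioi 0,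
          expPoly P ((twist P i)^[k] G) (mixRound h (insert i σ) (i.insertNth t x)))
          ∂(orthant m) := by
    rw [integral_sub i0 (integrable_finsetSum _ fun k _ => (ek k).1.const_mul _),
      integral_finsetSum _ fun k _ => (ek k).1.const_mul _]
    simp only [integral_const_mul]
    rw [mixIntegral, e0]
    simp only [(ek _).2]
  rw [hsum]
  have hbound : ∀ᵐ x ∂(orthant m), ‖(∫ t in Set.Ioi 0, expPoly P G
      (mixRound h σ (i.insertNth t x))) - ∑ k ∈ Finset.range (M + 2), toddCoeff k * h ^ k *
        ∫ t in Set.Ioi 0, expPoly P ((twist P i)^[k] G)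
          (mixRound h (insert i σ) (i.insertNth t x))‖ ≤
      C₁ * h ^ (M + 1) * (A ((twist P i)^[M + 1] G) * κ) * majorant x := by
    filter_upwards [ae_orthant_pos m] with x hx
    obtain ⟨z, hz1, hz2⟩ : ∃ z : Fin (m + 1) → ℝ,
        (∀ t, mixRound h σ (i.insertNth t x) = Function.update z i (roundUp h t)) ∧
        ∀ t, mixRound h (insert i σ) (i.insertNth t x) = Function.update z i t :=
      ⟨_, fun t => mixRound_insertNth h hi t x, fun t => mixRound_insert_insertNth h t x⟩
    have hpos : ∀ {t : ℝ}, 0 < t → ∀ j, 0 < (i.insertNth t x : Fin (m + 1) → ℝ) j := by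
      intro t ht j
      refine Fin.succAboveCases i ?_ (fun j => ?_) j
      · simpa using ht
      · simpa using hx j
    have hle : ∀ G' σ' {t : ℝ}, 0 < t → |expPoly P G' (mixRound h σ' (i.insertNth t x))| ≤
        A G' * majorant x * ((1 + t) ^ 2)⁻¹ := by
      intro G' σ' t ht
      refine (hA G' _ fun j => (hpos ht j).le.trans (le_mixRound hh _ _ _)).trans ?_
      rw [mul_assoc, mul_comm (majorant x), ← majorant_insertNth i]
      exact mul_le_mul_of_nonneg_left
        (majorant_anti (fun j => (hpos ht j).le) (le_mixRound hh _ _)) (hA0 _)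
    have hinn : ∀ G' σ', IntegrableOn (fun t => expPoly P G' (mixRound h σ' (i.insertNth t x)))
        (Set.Ioi 0) := by
      intro G' σ'
      refine (integrableOn_inv_sq.const_mul (A G' * majorant x)).mono' ?_ ?_
      · refine ((continuous_expPoly P G').measurable.comp ((measurable_mixRound h σ').comp
          ?_)).aestronglyMeasurable
        exact (continuous_id.finInsertNth i continuous_const).measurable
      · filter_upwards [ae_restrict_mem measurableSet_Ioi] with t ht
        exact hle G' σ' ht
    have key := hC₁ (F := fun k t => expPoly P ((twist P i)^[k] G) (Function.update z i t))
      (fun k t => by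
        rw [Function.iterate_succ_apply']
        exact hasDerivAt_expPoly_update P _ i z t)
      (fun k => by simpa only [hz2] using hinn ((twist P i)^[k] G) (insert i σ))
      hh (by simpa only [hz1, Function.iterate_zero, id] using hinn G σ)
    simp only [hz1, hz2]
    refine key.trans ?_
    rw [mul_assoc (C₁ * h ^ (M + 1))]
    refine mul_le_mul_of_nonneg_left ?_ (by positivity)
    rw [mul_right_comm, hκ, ← integral_const_mul]
    refine setIntegral_mono_on ?_ (integrableOn_inv_sq.const_mul _) measurableSet_Ioi ?_
    · have := hinn ((twist P i)^[M + 1] G) (insert i σ)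
      simp only [hz2] at this
      exact this.norm
    · intro t ht
      have := hle ((twist P i)^[M + 1] G) (insert i σ) ht
      simpa only [hz2] using this
  refine (norm_integral_le_of_norm_le ((integrable_majorant m).const_mul _) hbound).trans
    (le_of_eq ?_)
  rw [integral_const_mul]
  ring

end MahlerSeries

/-! ### Asymptotic expansion of the rounded integral in powers of h. -/

namespace MahlerSeries

open Finset MeasureTheory Set Filter Topology
open scoped Nat

theorem iterOp_add_single_nat {n : ℕ} {A : Type*} {D : Fin n → A → A}
    (hD : ∀ i j, Function.Commute (D i) (D j)) (δ : Fin n → ℕ) (i : Fin n) (k : ℕ) (a : A) :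
    iterOp D (δ + Pi.single i k) a = (D i)^[k] (iterOp D δ a) := by
  induction k with
  | zero => simp
  | succ k ih =>
    rw [Pi.single_add, ← add_assoc, iterOp_add_single hD, ih, Function.iterate_succ_apply']

/-- The multi-indices supported in `σ` with entries less than `K`. -/
def multiBox {n : ℕ} (σ : Finset (Fin n)) (K : ℕ) : Finset (Fin n → ℕ) :=
  Fintype.piFinset fun i => if i ∈ σ then Finset.range K else {0}

theorem mem_multiBox {n : ℕ} {σ : Finset (Fin n)} {K : ℕ} {δ : Fin n → ℕ} :
    δ ∈ multiBox σ K ↔ ∀ i, if i ∈ σ then δ i < K else δ i = 0 := by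
  rw [multiBox, Fintype.mem_piFinset]
  refine forall_congr' fun i => ?_
  split_ifs <;> simp

theorem sum_multiBox_insert {n : ℕ} {σ : Finset (Fin n)} {i : Fin n} (hi : i ∉ σ) (K : ℕ)
    (f : (Fin n → ℕ) → ℝ) :
    ∑ δ ∈ multiBox (insert i σ) K, f δ =
      ∑ δ ∈ multiBox σ K, ∑ k ∈ Finset.range K, f (δ + Pi.single i k) := by
  rw [← Finset.sum_product']
  symm
  refine Finset.sum_bij' (fun p _ => p.1 + Pi.single i p.2)
    (fun δ _ => (Function.update δ i 0, δ i)) ?_ ?_ ?_ ?_ ?_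
  · rintro ⟨δ, k⟩ h
    rw [Finset.mem_product, mem_multiBox, Finset.mem_range] at h
    rw [mem_multiBox]
    intro j
    by_cases hj : j = i
    · subst hj
      have := h.1 j
      simp only [hi, if_false] at this
      simpa [this] using h.2
    · simpa [hj, Pi.single_eq_of_ne hj] using h.1 j
  · intro δ h
    rw [mem_multiBox] at h
    rw [Finset.mem_product, mem_multiBox, Finset.mem_range]
    refine ⟨fun j => ?_, by simpa using h i⟩
    by_cases hj : j = i
    · subst hj
      simp [hi]
    · simpa [hj] using h j
  · rintro ⟨δ, k⟩ h
    rw [Finset.mem_product, mem_multiBox] at h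
    have h0 : δ i = 0 := by simpa [hi] using h.1 i
    refine Prod.ext ?_ (by simp [h0])
    ext j
    by_cases hj : j = i
    · subst hj
      simp [h0]
    · simp [hj]
  · intro δ _
    ext j
    by_cases hj : j = i
    · subst hj
      simp
    · simp [hj]
  · intro _ _
    rfl

theorem toddCoeff_zero : toddCoeff 0 = 1 := by simp [toddCoeff]

theorem prod_toddCoeff_add_single {n : ℕ} {δ : Fin n → ℕ} {i : Fin n} (hi : δ i = 0) (k : ℕ) :
    ∏ j, toddCoeff ((δ + Pi.single i k : Fin n → ℕ) j) =
      (∏ j, toddCoeff (δ j)) * toddCoeff k := by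
  rw [← Finset.mul_prod_erase _ _ (Finset.mem_univ i),
    ← Finset.mul_prod_erase _ (fun j => toddCoeff (δ j)) (Finset.mem_univ i), hi, toddCoeff_zero,
    one_mul, mul_comm]
  congr 1
  · refine Finset.prod_congr rfl fun j hj => ?_
    simp [Pi.single_eq_of_ne (Finset.ne_of_mem_erase hj)]
  · simp [hi]

theorem sum_add_single {n : ℕ} (δ : Fin n → ℕ) (i : Fin n) (k : ℕ) :
    ∑ j, (δ + Pi.single i k : Fin n → ℕ) j = ∑ j, δ j + k := by
  simp [Finset.sum_add_distrib]

/-- Coordinates are released from rounding one at a time. As `h ≤ 1`, the powers of `h` already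
present do not worsen the new errors. -/
theorem exists_mixIntegral_expansion {n d : ℕ} {P : MvPolynomial (Fin n) ℝ} (hP : IsElliptic P)
    (hPd : P.IsHomogeneous d) (hd : 1 ≤ d) (G : MvPolynomial (Fin n) ℝ) (M : ℕ)
    (σ : Finset (Fin n)) :
    ∃ C : ℝ, 0 ≤ C ∧ ∀ h : ℝ, 0 < h → h ≤ 1 →
      |mixIntegral P h ∅ G - ∑ δ ∈ multiBox σ (M + 2),
        (∏ j, toddCoeff (δ j)) * h ^ (∑ j, δ j) *
          mixIntegral P h σ (iterOp (twist P) δ G)| ≤ C * h ^ (M + 1) := by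
  induction σ using Finset.induction_on with
  | empty =>
    refine ⟨0, le_rfl, fun h hh h1 => ?_⟩
    have : multiBox (∅ : Finset (Fin n)) (M + 2) = {0} := by
      ext δ
      simp [mem_multiBox, funext_iff]
    simp [this, iterOp_zero, toddCoeff_zero]
  | insert i σ hi ih =>
    obtain ⟨C, hC0, hC⟩ := ih
    choose A hA using fun δ => exists_mixIntegral_step hP hPd hd (iterOp (twist P) δ G) M i
    refine ⟨C + ∑ δ ∈ multiBox σ (M + 2), |∏ j, toddCoeff (δ j)| * |A δ|, by positivity,
      fun h hh h1 => ?_⟩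
    rw [sum_multiBox_insert hi]
    have e1 : ∀ δ ∈ multiBox σ (M + 2), ∑ k ∈ Finset.range (M + 2),
        (∏ j, toddCoeff ((δ + Pi.single i k : Fin n → ℕ) j)) *
          h ^ (∑ j, (δ + Pi.single i k : Fin n → ℕ) j) *
          mixIntegral P h (insert i σ) (iterOp (twist P) (δ + Pi.single i k) G) =
        (∏ j, toddCoeff (δ j)) * h ^ (∑ j, δ j) * ∑ k ∈ Finset.range (M + 2),
          toddCoeff k * h ^ k *
            mixIntegral P h (insert i σ) ((twist P i)^[k] (iterOp (twist P) δ G)) := by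
      intro δ hδ
      have h0 : δ i = 0 := by simpa [hi] using mem_multiBox.1 hδ i
      rw [Finset.mul_sum]
      refine Finset.sum_congr rfl fun k _ => ?_
      rw [prod_toddCoeff_add_single h0, sum_add_single, iterOp_add_single_nat (twist_commute P),
        pow_add]
      ring
    rw [Finset.sum_congr rfl e1]
    have e2 : |(∑ δ ∈ multiBox σ (M + 2), (∏ j, toddCoeff (δ j)) * h ^ (∑ j, δ j) *
          mixIntegral P h σ (iterOp (twist P) δ G)) - ∑ δ ∈ multiBox σ (M + 2),
        (∏ j, toddCoeff (δ j)) * h ^ (∑ j, δ j) * ∑ k ∈ Finset.range (M + 2),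
          toddCoeff k * h ^ k *
            mixIntegral P h (insert i σ) ((twist P i)^[k] (iterOp (twist P) δ G))| ≤
        (∑ δ ∈ multiBox σ (M + 2), |∏ j, toddCoeff (δ j)| * |A δ|) * h ^ (M + 1) := by
      rw [← Finset.sum_sub_distrib, Finset.sum_mul]
      refine (Finset.abs_sum_le_sum_abs _ _).trans (Finset.sum_le_sum fun δ _ => ?_)
      rw [← mul_sub, abs_mul, abs_mul, abs_of_pos (pow_pos hh _), mul_assoc, mul_assoc]
      refine mul_le_mul_of_nonneg_left ?_ (abs_nonneg _)
      have h3 : h ^ (∑ j, δ j) ≤ 1 := pow_le_one₀ hh.le h1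
      have h4 := (hA δ σ hi h hh).trans
        (mul_le_mul_of_nonneg_right (le_abs_self (A δ)) (pow_pos hh _).le)
      exact (mul_le_mul h3 h4 (abs_nonneg _) zero_le_one).trans (by rw [one_mul])
    rw [add_mul]
    refine (abs_sub_le _ _ _).trans (add_le_add (hC h hh h1) e2)

/-- The coefficient of `h^j` in the asymptotic expansion of the rounded integral of
`G exp (-P)`. -/
noncomputable def moment {n : ℕ} (P G : MvPolynomial (Fin n) ℝ) (j : ℕ) : ℝ :=
  ∑ δ ∈ Delta n j, (∏ i, toddCoeff (δ i)) *
    ∫ x, expPoly P (iterOp (twist P) δ G) x ∂(orthant n)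

theorem mixIntegral_univ {n : ℕ} (P : MvPolynomial (Fin n) ℝ) (h : ℝ)
    (G : MvPolynomial (Fin n) ℝ) :
    mixIntegral P h Finset.univ G = ∫ x, expPoly P G x ∂(orthant n) := by
  simp only [mixIntegral, mixRound_univ]

theorem exists_mixIntegral_moment_succ {n d : ℕ} {P : MvPolynomial (Fin n) ℝ} (hP : IsElliptic P)
    (hPd : P.IsHomogeneous d) (hd : 1 ≤ d) (G : MvPolynomial (Fin n) ℝ) (M : ℕ) :
    ∃ C : ℝ, 0 ≤ C ∧ ∀ h : ℝ, 0 < h → h ≤ 1 →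
      |mixIntegral P h ∅ G - ∑ j ∈ Finset.range (M + 1), moment P G j * h ^ j| ≤
        C * h ^ (M + 1) := by
  obtain ⟨C, hC0, hC⟩ := exists_mixIntegral_expansion hP hPd hd G M Finset.univ
  set a : (Fin n → ℕ) → ℝ := fun δ => (∏ i, toddCoeff (δ i)) *
    ∫ x, expPoly P (iterOp (twist P) δ G) x ∂(orthant n) with ha
  -- The box contains every multi-index of size at most `M`; its other members, collected here,
  -- carry at least `h ^ (M + 1)` and join the error.
  set S := (multiBox (Finset.univ : Finset (Fin n)) (M + 2)).filter fun δ => ¬ ∑ j, δ j < M + 1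
  refine ⟨C + ∑ δ ∈ S, |a δ|, by positivity, fun h hh h1 => ?_⟩
  have e1 : ∑ δ ∈ multiBox Finset.univ (M + 2), (∏ j, toddCoeff (δ j)) * h ^ (∑ j, δ j) *
      mixIntegral P h Finset.univ (iterOp (twist P) δ G) =
      ∑ j ∈ Finset.range (M + 1), moment P G j * h ^ j + ∑ δ ∈ S, a δ * h ^ (∑ j, δ j) := by
    rw [← Finset.sum_filter_add_sum_filter_not _ (fun δ => ∑ j, δ j < M + 1)]
    congr 1
    · simp only [moment, Finset.sum_mul]
      rw [Finset.sum_sigma']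
      refine Finset.sum_bij' (fun δ _ => ⟨∑ j, δ j, δ⟩) (fun p _ => p.2) ?_ ?_ ?_ ?_ ?_
      · intro δ hδ
        rw [Finset.mem_filter] at hδ
        exact Finset.mem_sigma.2 ⟨Finset.mem_range.2 hδ.2, mem_Delta.2 rfl⟩
      · rintro ⟨j, δ⟩ hp
        rw [Finset.mem_sigma, Finset.mem_range, mem_Delta] at hp
        rw [Finset.mem_filter, mem_multiBox]
        simp only at hp ⊢
        refine ⟨fun i => ?_, by omega⟩
        have := Finset.single_le_sum (f := δ) (fun _ _ => Nat.zero_le _) (Finset.mem_univ i)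
        simp only [Finset.mem_univ, if_true]
        omega
      · intro _ _
        rfl
      · rintro ⟨j, δ⟩ hp
        rw [Finset.mem_sigma, mem_Delta] at hp
        obtain ⟨-, hp⟩ := hp
        simp only at hp
        subst hp
        rfl
      · intro δ _
        simp only [mixIntegral_univ]
        ring
    · refine Finset.sum_congr rfl fun δ _ => ?_
      rw [mixIntegral_univ, ha]
      ring
  have h2 := hC h hh h1
  rw [e1, ← sub_sub] at h2
  have h3 : |∑ δ ∈ S, a δ * h ^ (∑ j, δ j)| ≤ (∑ δ ∈ S, |a δ|) * h ^ (M + 1) := by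
    rw [Finset.sum_mul]
    refine (Finset.abs_sum_le_sum_abs _ _).trans (Finset.sum_le_sum fun δ hδ => ?_)
    rw [abs_mul, abs_of_pos (pow_pos hh _)]
    refine mul_le_mul_of_nonneg_left ?_ (abs_nonneg _)
    exact pow_le_pow_of_le_one hh.le h1 (not_lt.1 (Finset.mem_filter.1 hδ).2)
  rw [add_mul]
  refine le_trans ?_ (add_le_add h2 h3)
  refine le_trans (le_of_eq ?_) (abs_add_le _ _)
  rw [sub_add_cancel]

theorem exists_mixIntegral_moment {n d : ℕ} {P : MvPolynomial (Fin n) ℝ} (hP : IsElliptic P)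
    (hPd : P.IsHomogeneous d) (hd : 1 ≤ d) (G : MvPolynomial (Fin n) ℝ) (J : ℕ) :
    ∃ C : ℝ, 0 ≤ C ∧ ∀ h : ℝ, 0 < h → h ≤ 1 →
      |mixIntegral P h ∅ G - ∑ j ∈ Finset.range J, moment P G j * h ^ j| ≤ C * h ^ J := by
  cases J with
  | succ M => exact exists_mixIntegral_moment_succ hP hPd hd G M
  | zero =>
    obtain ⟨C, hC0, hC⟩ := exists_mixIntegral_moment_succ hP hPd hd G 0
    refine ⟨C + |moment P G 0|, by positivity, fun h hh h1 => ?_⟩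
    have h2 := hC h hh h1
    simp only [zero_add, Finset.range_one, Finset.sum_singleton, pow_zero, mul_one, pow_one] at h2
    simp only [Finset.range_zero, Finset.sum_empty, sub_zero, pow_zero, mul_one]
    have h3 := abs_sub_abs_le_abs_sub (mixIntegral P h ∅ G) (moment P G 0)
    have h4 := mul_le_mul_of_nonneg_left h1 hC0
    linarith

end MahlerSeries

/-! ### The theta function: convergence, decay and expansion at zero. -/

namespace MahlerSeries

open Finset MeasureTheory Set Filter Topology Asymptotics
open scoped Nat

/-- The half-open cube of side `h` with upper corner `h m`. -/
def gridCube {n : ℕ} (h : ℝ) (m : Fin n → ℕ+) : Set (Fin n → ℝ) :=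
  Set.univ.pi fun i => Set.Ioc (h * (m i).natPred) (h * (m i).natPred + h)

theorem natPred_cast_add_one (k : ℕ+) : ((k.natPred : ℕ) : ℝ) + 1 = ((k : ℕ) : ℝ) := by
  exact_mod_cast k.natPred_add_one

theorem mixRound_of_mem_gridCube {n : ℕ} {h : ℝ} (hh : 0 < h) {m : Fin n → ℕ+} {x : Fin n → ℝ}
    (hx : x ∈ gridCube h m) : mixRound h ∅ x = fun i => h * ((m i : ℕ) : ℝ) := by
  ext i
  have := roundUp_eq hh _ (hx i (Set.mem_univ i))
  simp only [mixRound, Finset.notMem_empty, if_false, this]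
  rw [← natPred_cast_add_one]
  ring

theorem iUnion_gridCube {n : ℕ} {h : ℝ} (hh : 0 < h) :
    ⋃ m : Fin n → ℕ+, gridCube h m = Set.univ.pi fun _ => Set.Ioi 0 := by
  ext x
  simp only [Set.mem_iUnion, gridCube, Set.mem_pi, Set.mem_univ, true_implies, Set.mem_Ioi,
    Set.mem_Ioc]
  constructor
  · rintro ⟨m, hm⟩ i
    exact lt_of_le_of_lt (by positivity) (hm i).1
  · intro hx
    refine ⟨fun i => ⟨⌈x i / h⌉₊, Nat.ceil_pos.2 (div_pos (hx i) hh)⟩, fun i => ?_⟩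
    set k : ℕ+ := ⟨⌈x i / h⌉₊, Nat.ceil_pos.2 (div_pos (hx i) hh)⟩ with hk
    have h1 := natPred_cast_add_one k
    have h2 : ((k : ℕ) : ℝ) = ⌈x i / h⌉₊ := rfl
    have h3 := Nat.le_ceil (x i / h)
    have h4 := Nat.ceil_lt_add_one (div_pos (hx i) hh).le
    rw [← h2, ← h1] at h3 h4
    rw [div_le_iff₀ hh] at h3
    have h5 : (k.natPred : ℝ) < x i / h := by linarith
    rw [lt_div_iff₀ hh] at h5
    constructor <;> linarith

theorem pairwise_disjoint_gridCube {n : ℕ} {h : ℝ} (hh : 0 < h) :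
    Pairwise (Function.onFun Disjoint fun m : Fin n → ℕ+ => gridCube h m) := by
  intro m m' hne
  refine Set.disjoint_left.2 fun x hx hx' => hne ?_
  have h1 := mixRound_of_mem_gridCube hh hx
  rw [mixRound_of_mem_gridCube hh hx'] at h1
  ext i
  have := congrFun h1 i
  have h2 := mul_left_cancel₀ hh.ne' this
  exact_mod_cast h2.symm

theorem volume_gridCube {n : ℕ} {h : ℝ} (hh : 0 < h) (m : Fin n → ℕ+) :
    (volume : Measure (Fin n → ℝ)).real (gridCube h m) = h ^ n := by
  rw [Measure.real, gridCube, volume_pi_pi]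
  simp [Real.volume_Ioc, hh.le]

/-- The grid cubes tile the orthant and the rounded function is constant on each, so countable
additivity of the integral gives the sum. In particular integrability yields summability over the
lattice. -/
theorem hasSum_grid {n : ℕ} {h : ℝ} (hh : 0 < h) {f : (Fin n → ℝ) → ℝ}
    (hf : Integrable (fun x => f (mixRound h ∅ x)) (orthant n)) :
    HasSum (fun m : Fin n → ℕ+ => h ^ n * f fun i => h * ((m i : ℕ) : ℝ))
      (∫ x, f (mixRound h ∅ x) ∂(orthant n)) := by
  rw [orthant_eq_restrict, ← iUnion_gridCube hh] at hf ⊢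
  have hmeas : ∀ m : Fin n → ℕ+, MeasurableSet (gridCube h m) := fun m =>
    MeasurableSet.univ_pi fun _ => measurableSet_Ioc
  refine (hasSum_integral_iUnion hmeas (pairwise_disjoint_gridCube hh) hf).congr_fun fun m => ?_
  rw [setIntegral_congr_fun (hmeas m) fun x hx => by rw [mixRound_of_mem_gridCube hh hx],
    setIntegral_const, volume_gridCube hh, smul_eq_mul]

theorem integrableOn_roundUp_rpow {p : ℝ} (hp : 1 < p) :
    IntegrableOn (fun t => (roundUp 1 t) ^ (-p)) (Set.Ioi 0) := by
  have h1 := (integrableOn_add_rpow_Ioi_of_lt (a := -p) (c := 0) (m := 1) (by linarith)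
    (by norm_num)).const_mul ((2 : ℝ) ^ p)
  refine h1.mono' ((measurable_roundUp 1).pow_const _).aestronglyMeasurable ?_
  filter_upwards [ae_restrict_mem measurableSet_Ioi] with t ht
  have ht' : (0 : ℝ) < t := ht
  have h2 : 1 ≤ roundUp 1 t := by
    have : 1 ≤ ⌈t / 1⌉₊ := Nat.ceil_pos.2 (by simpa using ht')
    rw [roundUp, one_mul]
    exact_mod_cast this
  have h3 := le_roundUp one_pos t
  rw [Real.norm_of_nonneg (by positivity)]
  have h4 : (2 : ℝ) ^ p * (t + 1) ^ (-p) = ((t + 1) / 2) ^ (-p) := by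
    rw [Real.div_rpow (by linarith) (by norm_num), Real.rpow_neg (show (0 : ℝ) ≤ 2 by norm_num),
      div_inv_eq_mul, mul_comm]
  rw [h4]
  exact Real.rpow_le_rpow_of_nonpos (by positivity) (by linarith) (by linarith)

theorem summable_prod_rpow {n : ℕ} {p : ℝ} (hp : 1 < p) :
    Summable fun m : Fin n → ℕ+ => ∏ i, (((m i : ℕ) : ℝ)) ^ (-p) := by
  have hf : Integrable (fun x : Fin n → ℝ => ∏ i, (mixRound 1 ∅ x i) ^ (-p)) (orthant n) :=
    Integrable.fintype_prod (f := fun _ t => (roundUp 1 t) ^ (-p)) fun _ =>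
      integrableOn_roundUp_rpow hp
  simpa using (hasSum_grid one_pos (f := fun x => ∏ i, x i ^ (-p)) hf).summable

/-- The tuple `m` as a point of `ℝ^n`. -/
def natPoint {n : ℕ} (m : Fin n → ℕ+) : Fin n → ℝ := fun i => ((m i : ℕ) : ℝ)

theorem one_le_natPoint {n : ℕ} (m : Fin n → ℕ+) (i : Fin n) : 1 ≤ natPoint m i := by
  exact Nat.one_le_cast.2 (m i).pos

theorem natPoint_nonneg {n : ℕ} (m : Fin n → ℕ+) (i : Fin n) : 0 ≤ natPoint m i :=
  zero_le_one.trans (one_le_natPoint m i)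

theorem one_le_norm_natPoint {n : ℕ} (hn : 1 ≤ n) (m : Fin n → ℕ+) : 1 ≤ ‖natPoint m‖ :=
  (one_le_natPoint m ⟨0, hn⟩).trans
    ((le_abs_self _).trans (norm_le_pi_norm (natPoint m) ⟨0, hn⟩))

theorem natPoint_ne_zero {n : ℕ} (hn : 1 ≤ n) (m : Fin n → ℕ+) : natPoint m ≠ 0 := by
  intro h
  have := one_le_norm_natPoint hn m
  rw [h, norm_zero] at this
  linarith

theorem summable_abs_eval_div_rpow {n d q : ℕ} (hn : 1 ≤ n) (hd : 1 ≤ d)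
    {P Q : MvPolynomial (Fin n) ℝ} (hP : IsElliptic P) (hPd : P.IsHomogeneous d)
    (hQ : Q.IsHomogeneous q) {s : ℝ} (hs : ((n : ℝ) + q) / d < s) :
    Summable fun m : Fin n → ℕ+ =>
      |MvPolynomial.eval (natPoint m) Q| / MvPolynomial.eval (natPoint m) P ^ s := by
  obtain ⟨c, hc0, hc⟩ := hP.exists_le_eval hPd hd
  obtain ⟨C, hC0, hC⟩ := exists_abs_eval_le_of_isHomogeneous hQ
  have hn' : (0 : ℝ) < n := by exact_mod_cast hn
  have hd' : (0 : ℝ) < d := by exact_mod_cast hd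
  rw [div_lt_iff₀ hd'] at hs
  -- Chosen so that $r^{q-ds}=r^{-pn}$: the decay is shared equally by the `n` coordinates, each at
  -- most `r`, and the hypothesis on `s` says `p > 1`.
  set p : ℝ := (s * d - q) / n with hp
  have hp1 : 1 < p := by
    rw [hp, lt_div_iff₀ hn']
    linarith
  have hs0 : 0 ≤ s := by
    by_contra hneg
    have := mul_neg_of_neg_of_pos (not_le.1 hneg) hd'
    linarith [(Nat.cast_nonneg q : (0 : ℝ) ≤ q)]
  refine Summable.of_nonneg_of_le (fun m => ?_) (fun m => ?_)
    ((summable_prod_rpow (n := n) hp1).mul_left (C / c ^ s))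
  · exact div_nonneg (abs_nonneg _)
      (Real.rpow_nonneg (hP.eval_pos hPd (natPoint_nonneg m) (natPoint_ne_zero hn m)).le _)
  · set r := ‖natPoint m‖ with hr
    have hr1 : 1 ≤ r := one_le_norm_natPoint hn m
    have hr0 : 0 < r := by linarith
    have h1 : |MvPolynomial.eval (natPoint m) Q| ≤ C * r ^ q :=
      hC _ (natPoint_nonneg m) (natPoint_ne_zero hn m)
    have h2 : c ^ s * r ^ (d * s) ≤ MvPolynomial.eval (natPoint m) P ^ s := by
      have h3 := hc _ (natPoint_nonneg m)
      have h4 := Real.rpow_le_rpow (by positivity) h3 hs0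
      rwa [Real.mul_rpow hc0.le (by positivity), ← Real.rpow_natCast, ← Real.rpow_mul hr0.le] at h4
    have h5 : r ^ (-(p * n)) ≤ ∏ i, (((m i : ℕ) : ℝ)) ^ (-p) := by
      calc r ^ (-(p * n)) = ∏ _i : Fin n, r ^ (-p) := by
            rw [Finset.prod_const, Finset.card_univ, Fintype.card_fin, ← Real.rpow_natCast,
              ← Real.rpow_mul hr0.le, neg_mul]
        _ ≤ ∏ i, (((m i : ℕ) : ℝ)) ^ (-p) := by
            refine Finset.prod_le_prod (fun i _ => by positivity) fun i _ => ?_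
            refine Real.rpow_le_rpow_of_nonpos ?_ ?_ (by linarith)
            · exact zero_lt_one.trans_le (one_le_natPoint m i)
            · exact (le_abs_self _).trans (norm_le_pi_norm (natPoint m) i)
    refine (div_le_div₀ (by positivity) h1 (by positivity) h2).trans ?_
    refine le_trans (le_of_eq ?_) (mul_le_mul_of_nonneg_left h5 (by positivity))
    have h6 : -(p * n) = (q : ℝ) - d * s := by
      rw [hp]
      field_simp
      ring
    rw [h6, Real.rpow_sub hr0, Real.rpow_natCast]
    field_simp

/-- The theta function `∑_m Q(m) exp (-t P(m))`. -/
noncomputable def theta {n : ℕ} (P Q : MvPolynomial (Fin n) ℝ) (t : ℝ) : ℝ :=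
  ∑' m : Fin n → ℕ+,
    MvPolynomial.eval (natPoint m) Q * Real.exp (-MvPolynomial.eval (natPoint m) P * t)

/-- Scaling by `h` multiplies `Q` by `h ^ q` and `P` by `h ^ d`, and a grid cube has volume `h ^ n`.
-/
theorem hasSum_theta_aux {n d q : ℕ} (hd : 1 ≤ d)
    {P Q : MvPolynomial (Fin n) ℝ} (hP : IsElliptic P) (hPd : P.IsHomogeneous d)
    (hQ : Q.IsHomogeneous q) {h : ℝ} (hh : 0 < h) :
    HasSum (fun m : Fin n → ℕ+ => MvPolynomial.eval (natPoint m) Q *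
      Real.exp (-MvPolynomial.eval (natPoint m) P * h ^ d))
      ((h ^ (n + q))⁻¹ * mixIntegral P h ∅ Q) := by
  obtain ⟨C, hC0, hC⟩ := hP.exists_abs_expPoly_le hPd hd Q
  have h1 := (hasSum_grid hh (integrable_expPoly_mixRound hC0 hC hh ∅)).mul_left (h ^ (n + q))⁻¹
  refine h1.congr_fun fun m => ?_
  have h2 : (fun i => h * ((m i : ℕ) : ℝ)) = h • natPoint m := rfl
  rw [h2, expPoly, eval_smul_of_isHomogeneous hQ, eval_smul_of_isHomogeneous hPd, pow_add,
    neg_mul, mul_comm (h ^ d)]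
  field_simp

theorem rpow_inv_pow {d : ℕ} (hd : 1 ≤ d) {t : ℝ} (ht : 0 < t) :
    (t ^ ((d : ℝ)⁻¹)) ^ d = t :=
  Real.rpow_inv_natCast_pow ht.le (by omega)

theorem hasSum_theta {n d q : ℕ} (hd : 1 ≤ d)
    {P Q : MvPolynomial (Fin n) ℝ} (hP : IsElliptic P) (hPd : P.IsHomogeneous d)
    (hQ : Q.IsHomogeneous q) {t : ℝ} (ht : 0 < t) :
    HasSum (fun m : Fin n → ℕ+ => MvPolynomial.eval (natPoint m) Q *
      Real.exp (-MvPolynomial.eval (natPoint m) P * t)) (theta P Q t) := by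
  have := hasSum_theta_aux hd hP hPd hQ (Real.rpow_pos_of_pos ht (d : ℝ)⁻¹)
  rw [rpow_inv_pow hd ht] at this
  exact this.summable.hasSum

theorem theta_eq {n d q : ℕ} (hd : 1 ≤ d)
    {P Q : MvPolynomial (Fin n) ℝ} (hP : IsElliptic P) (hPd : P.IsHomogeneous d)
    (hQ : Q.IsHomogeneous q) {t : ℝ} (ht : 0 < t) :
    theta P Q t = ((t ^ ((d : ℝ)⁻¹)) ^ (n + q))⁻¹ * mixIntegral P (t ^ ((d : ℝ)⁻¹)) ∅ Q := by
  have := hasSum_theta_aux hd hP hPd hQ (Real.rpow_pos_of_pos ht (d : ℝ)⁻¹)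
  rw [rpow_inv_pow hd ht] at this
  exact this.tsum_eq

theorem continuousOn_theta {n d q : ℕ} (hn : 1 ≤ n) (hd : 1 ≤ d)
    {P Q : MvPolynomial (Fin n) ℝ} (hP : IsElliptic P) (hPd : P.IsHomogeneous d)
    (hQ : Q.IsHomogeneous q) : ContinuousOn (theta P Q) (Set.Ioi 0) := by
  intro t ht
  have ht2 : 0 < t / 2 := half_pos ht
  have hcont : ContinuousOn (theta P Q) (Set.Ioi (t / 2)) := by
    refine continuousOn_tsum (fun m => ?_) (hasSum_theta hd hP hPd hQ ht2).summable.abs ?_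
    · fun_prop
    · intro m x hx
      rw [Real.norm_eq_abs, abs_mul, abs_mul, Real.abs_exp, Real.abs_exp]
      refine mul_le_mul_of_nonneg_left (Real.exp_le_exp.2 ?_) (abs_nonneg _)
      have hpos := hP.eval_pos hPd (natPoint_nonneg m) (natPoint_ne_zero hn m)
      have hx' : t / 2 < x := hx
      nlinarith
  exact (hcont.continuousAt (Ioi_mem_nhds (half_lt_self ht))).continuousWithinAt

/-- All lattice points have norm at least 1, so `P ≥ c` on them and for `t ≥ 1` each term is at most
exp(-c(t-1)) times its value at `t = 1`. -/
theorem theta_isBigO_exp {n d q : ℕ} (hn : 1 ≤ n) (hd : 1 ≤ d)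
    {P Q : MvPolynomial (Fin n) ℝ} (hP : IsElliptic P) (hPd : P.IsHomogeneous d)
    (hQ : Q.IsHomogeneous q) :
    ∃ c : ℝ, 0 < c ∧ theta P Q =O[atTop] fun t => Real.exp (-c * t) := by
  obtain ⟨c, hc0, hc⟩ := hP.exists_le_eval hPd hd
  refine ⟨c, hc0, ?_⟩
  have hs := (hasSum_theta hd hP hPd hQ one_pos).summable.abs
  refine IsBigO.of_bound (Real.exp c * ∑' m : Fin n → ℕ+,
    |MvPolynomial.eval (natPoint m) Q * Real.exp (-MvPolynomial.eval (natPoint m) P * 1)|) ?_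
  filter_upwards [eventually_ge_atTop 1] with t ht
  have ht0 : 0 < t := by linarith
  have hst := (hasSum_theta hd hP hPd hQ ht0).summable.abs
  have h1 : ‖theta P Q t‖ ≤ ∑' m : Fin n → ℕ+,
      |MvPolynomial.eval (natPoint m) Q * Real.exp (-MvPolynomial.eval (natPoint m) P * t)| :=
    norm_tsum_le_tsum_norm hst
  refine h1.trans ?_
  rw [Real.norm_of_nonneg (Real.exp_pos _).le, mul_right_comm, ← tsum_mul_left]
  refine hst.tsum_le_tsum (fun m => ?_) (hs.mul_left _)
  rw [abs_mul, abs_mul, Real.abs_exp, Real.abs_exp, mul_left_comm]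
  refine mul_le_mul_of_nonneg_left ?_ (abs_nonneg _)
  rw [← Real.exp_add, ← Real.exp_add, Real.exp_le_exp]
  have hcm : c ≤ MvPolynomial.eval (natPoint m) P := by
    refine le_trans ?_ (hc _ (natPoint_nonneg m))
    exact le_mul_of_one_le_right hc0.le (one_le_pow₀ (one_le_norm_natPoint hn m))
  nlinarith

/-- The exponents of the asymptotic expansion of the theta function at `0`. -/
noncomputable def thetaExponent (n d q j : ℕ) : ℝ := ((j : ℝ) - n - q) / d

theorem rpow_thetaExponent {n d q : ℕ} {t : ℝ} (ht : 0 < t) (j : ℕ) :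
    ((t ^ ((d : ℝ)⁻¹)) ^ (n + q))⁻¹ * (t ^ ((d : ℝ)⁻¹)) ^ j = t ^ thetaExponent n d q j := by
  rw [← Real.rpow_natCast, ← Real.rpow_natCast, ← Real.rpow_mul ht.le, ← Real.rpow_mul ht.le,
    ← Real.rpow_neg ht.le, ← Real.rpow_add ht, thetaExponent]
  congr 1
  push_cast
  rw [div_eq_inv_mul]
  ring

/-- The expansion of the rounded integral at $h=t^{1/d}$, divided by $h^{n+q}$. -/
theorem theta_sub_isBigO {n d q : ℕ} (hd : 1 ≤ d)
    {P Q : MvPolynomial (Fin n) ℝ} (hP : IsElliptic P) (hPd : P.IsHomogeneous d)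
    (hQ : Q.IsHomogeneous q) (J : ℕ) :
    (fun t => theta P Q t - ∑ j ∈ Finset.range J, moment P Q j * t ^ thetaExponent n d q j)
      =O[𝓝[>] 0] fun t => t ^ thetaExponent n d q J := by
  obtain ⟨C, hC0, hC⟩ := exists_mixIntegral_moment hP hPd hd Q J
  refine IsBigO.of_bound C ?_
  filter_upwards [Ioc_mem_nhdsGT (zero_lt_one' ℝ)] with t ht
  have ht0 : 0 < t := ht.1
  set h := t ^ ((d : ℝ)⁻¹) with hh
  have hpos : 0 < h := Real.rpow_pos_of_pos ht0 _
  have h1 : h ≤ 1 := Real.rpow_le_one ht0.le ht.2 (by positivity)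
  have h2 := mul_le_mul_of_nonneg_left (hC h hpos h1) (inv_pos.2 (pow_pos hpos (n + q))).le
  rw [Real.norm_of_nonneg (Real.rpow_nonneg ht0.le _), ← rpow_thetaExponent ht0, ← hh,
    mul_left_comm]
  refine le_trans (le_of_eq ?_) h2
  rw [Real.norm_eq_abs, theta_eq hd hP hPd hQ ht0, ← abs_of_pos (inv_pos.2 (pow_pos hpos (n + q))),
    ← abs_mul, abs_of_pos (inv_pos.2 (pow_pos hpos (n + q))), mul_sub, Finset.mul_sum, ← hh]
  congr 2
  refine Finset.sum_congr rfl fun j _ => ?_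
  rw [← rpow_thetaExponent ht0, ← hh]
  ring

end MahlerSeries

/-! ### Mellin continuation from a power expansion, and its values at negative integers. -/

namespace MahlerSeries

open Finset MeasureTheory Set Filter Topology Asymptotics
open scoped Nat

/-- A function on `(0, ∞)` of rapid decay at `∞` with an asymptotic expansion `∑_j c_j t^{e_j}`
at `0`. -/
structure HasPowerExpansion (f : ℝ → ℂ) (c : ℕ → ℂ) (e : ℕ → ℝ) : Prop where
  locallyIntegrableOn : LocallyIntegrableOn f (Set.Ioi 0)
  isBigO_top : ∀ a : ℝ, f =O[atTop] fun t => t ^ (-a)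
  isBigO_zero : ∀ J : ℕ, (fun t => f t - ∑ j ∈ Finset.range J, c j * ((t ^ e j : ℝ) : ℂ))
    =O[𝓝[>] 0] fun t => t ^ e J
  monotone : Monotone e
  tendsto : Tendsto e atTop atTop

/-- The function `t ↦ t^a` cut off at `1`. -/
noncomputable def cutPow (a : ℝ) : ℝ → ℂ :=
  Set.indicator (Set.Ioc 0 1) fun t => (t : ℂ) ^ (a : ℂ)

/-- The remainder of the expansion after `J` terms. -/
noncomputable def cutRemainder (f : ℝ → ℂ) (c : ℕ → ℂ) (e : ℕ → ℝ) (J : ℕ) (t : ℝ) : ℂ :=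
  f t - ∑ j ∈ Finset.range J, c j * cutPow (e j) t

/-- The continuation of the Mellin transform given by the first `J` terms of the expansion. -/
noncomputable def mellinCont (f : ℝ → ℂ) (c : ℕ → ℂ) (e : ℕ → ℝ) (J : ℕ) (s : ℂ) : ℂ :=
  mellin (cutRemainder f c e J) s + ∑ j ∈ Finset.range J, c j / (s + e j)

theorem locallyIntegrableOn_cutPow (a : ℝ) : LocallyIntegrableOn (cutPow a) (Set.Ioi 0) := by
  have h1 : LocallyIntegrableOn (fun t : ℝ => (t : ℂ) ^ (a : ℂ)) (Set.Ioi 0) := by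
    refine ContinuousOn.locallyIntegrableOn ?_ measurableSet_Ioi
    exact continuousOn_of_forall_continuousAt fun t ht =>
      Complex.continuousAt_ofReal_cpow_const _ _ (Or.inr (ne_of_gt ht))
  intro x hx
  obtain ⟨s, hs, h⟩ := h1 x hx
  exact ⟨s, hs, h.indicator measurableSet_Ioc⟩

namespace HasPowerExpansion

variable {f : ℝ → ℂ} {c : ℕ → ℂ} {e : ℕ → ℝ}

theorem locallyIntegrableOn_remainder (hf : HasPowerExpansion f c e) (J : ℕ) :
    LocallyIntegrableOn (cutRemainder f c e J) (Set.Ioi 0) := by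
  induction J with
  | zero =>
    have : cutRemainder f c e 0 = f := by
      ext t
      simp [cutRemainder]
    rw [this]
    exact hf.locallyIntegrableOn
  | succ J ih =>
    have : cutRemainder f c e (J + 1) = fun t => cutRemainder f c e J t -
        c J * cutPow (e J) t := by
      ext t
      simp only [cutRemainder, Finset.sum_range_succ]
      ring
    rw [this]
    refine ih.sub ?_
    intro x hx
    obtain ⟨s, hs, h⟩ := locallyIntegrableOn_cutPow (e J) x hx
    exact ⟨s, hs, h.const_mul _⟩

theorem remainder_isBigO_top (hf : HasPowerExpansion f c e) (J : ℕ) (a : ℝ) :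
    cutRemainder f c e J =O[atTop] fun t => t ^ (-a) := by
  refine (hf.isBigO_top a).congr' ?_ EventuallyEq.rfl
  filter_upwards [eventually_gt_atTop 1] with t ht
  rw [cutRemainder, Finset.sum_eq_zero, sub_zero]
  intro j _
  rw [cutPow, Set.indicator_of_notMem, mul_zero]
  exact fun h => absurd h.2 (not_le.2 ht)

theorem remainder_isBigO_zero (hf : HasPowerExpansion f c e) (J : ℕ) :
    cutRemainder f c e J =O[𝓝[>] 0] fun t => t ^ (-(-e J)) := by
  rw [neg_neg]
  refine (hf.isBigO_zero J).congr' ?_ EventuallyEq.rfl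
  filter_upwards [Ioc_mem_nhdsGT (zero_lt_one' ℝ)] with t ht
  rw [cutRemainder]
  congr 1
  refine Finset.sum_congr rfl fun j _ => ?_
  rw [cutPow, Set.indicator_of_mem ht, Complex.ofReal_cpow ht.1.le]

theorem mellinConvergent_remainder (hf : HasPowerExpansion f c e) (J : ℕ) {s : ℂ}
    (hs : -e J < s.re) : MellinConvergent (cutRemainder f c e J) s :=
  mellinConvergent_of_isBigO_rpow (hf.locallyIntegrableOn_remainder J)
    (hf.remainder_isBigO_top J (s.re + 1)) (lt_add_one _) (hf.remainder_isBigO_zero J) hs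

theorem isOpen_halfPlane (a : ℝ) : IsOpen {s : ℂ | a < s.re} :=
  isOpen_lt continuous_const Complex.continuous_re

theorem analyticAt_mellin_remainder (hf : HasPowerExpansion f c e) (J : ℕ) {s : ℂ}
    (hs : -e J < s.re) : AnalyticAt ℂ (mellin (cutRemainder f c e J)) s := by
  have hd : DifferentiableOn ℂ (mellin (cutRemainder f c e J)) {s : ℂ | -e J < s.re} :=
    fun z hz => (mellin_differentiableAt_of_isBigO_rpow (hf.locallyIntegrableOn_remainder J)
      (hf.remainder_isBigO_top J (z.re + 1)) (lt_add_one _) (hf.remainder_isBigO_zero J)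
      hz).differentiableWithinAt
  exact hd.analyticAt ((isOpen_halfPlane _).mem_nhds hs)

/-- On this half plane the transform of the cut-off power is `1 / (s + e J)`; subtracting that power
from the function and adding the fraction cancel. -/
theorem mellinCont_succ (hf : HasPowerExpansion f c e) (J : ℕ) {s : ℂ} (hs : -e J < s.re) :
    mellinCont f c e (J + 1) s = mellinCont f c e J s := by
  have h1 := hf.mellinConvergent_remainder J hs
  have h2 : HasMellin (cutPow (e J)) s (1 / (s + e J)) :=
    hasMellin_cpow_Ioc (e J : ℂ) (by rw [Complex.ofReal_re]; linarith)
  have h3 := hasMellin_sub h1 (hasMellin_const_smul h2.1 (c J)).1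
  have h4 : cutRemainder f c e (J + 1) = fun t => cutRemainder f c e J t -
      c J • cutPow (e J) t := by
    ext t
    simp only [cutRemainder, Finset.sum_range_succ, smul_eq_mul]
    ring
  rw [mellinCont, mellinCont, h4, h3.2, mellin_const_smul, h2.2, Finset.sum_range_succ,
    smul_eq_mul]
  ring

theorem mellinCont_eq (hf : HasPowerExpansion f c e) {J K : ℕ} (hJK : J ≤ K) {s : ℂ}
    (hs : -e J < s.re) : mellinCont f c e K s = mellinCont f c e J s := by
  induction K, hJK using Nat.le_induction with
  | base => rfl
  | succ K hK ih =>
    rw [hf.mellinCont_succ K ?_, ih]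
    have := hf.monotone hK
    linarith

theorem mellinCont_eq' (hf : HasPowerExpansion f c e) {J K : ℕ} {s : ℂ}
    (hJ : -e J < s.re) (hK : -e K < s.re) : mellinCont f c e K s = mellinCont f c e J s := by
  rcases le_total J K with h | h
  · exact hf.mellinCont_eq h hJ
  · exact (hf.mellinCont_eq h hK).symm

theorem mellinCont_zero : mellinCont f c e 0 = mellin f := by
  ext s
  have : cutRemainder f c e 0 = f := by
    ext t
    simp [cutRemainder]
  simp [mellinCont, this]

theorem exists_exponent_lt (hf : HasPowerExpansion f c e) (s : ℂ) : ∃ J, -e J < s.re := by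
  obtain ⟨J, hJ⟩ := (hf.tendsto.eventually_gt_atTop (-s.re)).exists
  exact ⟨J, by linarith⟩

theorem meromorphicAt_mellinCont (hf : HasPowerExpansion f c e) (J : ℕ) {s : ℂ}
    (hs : -e J < s.re) : MeromorphicAt (mellinCont f c e J) s := by
  refine MeromorphicAt.add (hf.analyticAt_mellin_remainder J hs).meromorphicAt ?_
  have : (fun s : ℂ => ∑ j ∈ Finset.range J, c j / (s + e j)) =
      ∑ j ∈ Finset.range J, fun s : ℂ => c j / (s + e j) := by
    ext s
    simp
  rw [this]
  refine MeromorphicAt.sum fun j => ?_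
  fun_prop

theorem analyticAt_inv_Gamma (s : ℂ) : AnalyticAt ℂ (fun s => (Complex.Gamma s)⁻¹) s :=
  Complex.differentiable_one_div_Gamma.analyticAt s

/-- The Mellin transform divided by the Gamma function continues meromorphically to `ℂ`, with the
continuation given on half planes by the partial expansions. -/
theorem exists_continuation (hf : HasPowerExpansion f c e) :
    ∃ Z : ℂ → ℂ, MeromorphicNFOn Z Set.univ ∧
      (∀ s : ℂ, -e 0 < s.re → Z s = mellin f s * (Complex.Gamma s)⁻¹) ∧
      ∀ (J : ℕ) (s : ℂ), -e J < s.re →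
        Z =ᶠ[𝓝[≠] s] fun z => mellinCont f c e J z * (Complex.Gamma z)⁻¹ := by
  -- Each point selects its own truncation. Different truncations agree wherever both are valid, so
  -- the glued function is locally one of them.
  choose K hK using hf.exists_exponent_lt
  set Y : ℂ → ℂ := fun s => mellinCont f c e (K s) s * (Complex.Gamma s)⁻¹ with hY
  have hYJ : ∀ (J : ℕ) (s : ℂ), -e J < s.re →
      Y =ᶠ[𝓝 s] fun z => mellinCont f c e J z * (Complex.Gamma z)⁻¹ := by
    intro J s hs
    filter_upwards [(isOpen_halfPlane (-e J)).mem_nhds hs] with z hz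
    simp only [hY]
    rw [hf.mellinCont_eq' hz (hK z)]
  have hmer : MeromorphicOn Y Set.univ := by
    intro s _
    refine MeromorphicAt.congr ?_ ((hYJ (K s) s (hK s)).symm.filter_mono nhdsWithin_le_nhds)
    exact (hf.meromorphicAt_mellinCont (K s) (hK s)).mul (analyticAt_inv_Gamma s).meromorphicAt
  refine ⟨toMeromorphicNFOn Y Set.univ, meromorphicNFOn_toMeromorphicNFOn Y Set.univ, ?_, ?_⟩
  · intro s hs
    have h1 : AnalyticAt ℂ (fun z => mellinCont f c e 0 z * (Complex.Gamma z)⁻¹) s := by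
      refine AnalyticAt.mul ?_ (analyticAt_inv_Gamma s)
      have : cutRemainder f c e 0 = f := by
        ext t
        simp [cutRemainder]
      have h2 := hf.analyticAt_mellin_remainder 0 hs
      rwa [this, ← mellinCont_zero (c := c) (e := e)] at h2
    have h2 : AnalyticAt ℂ Y s := h1.congr (hYJ 0 s hs).symm
    rw [toMeromorphicNFOn_eq_toMeromorphicNFAt hmer (Set.mem_univ s),
      toMeromorphicNFAt_eq_self.2 h2.meromorphicNFAt, (hYJ 0 s hs).eq_of_nhds, mellinCont_zero]
  · intro J s hs
    exact (hmer.toMeromorphicNFOn_eq_self_on_nhdsNE (Set.mem_univ s)).trans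
      ((hYJ J s hs).filter_mono nhdsWithin_le_nhds)

end HasPowerExpansion

/-- The reciprocal Gamma function has a simple zero at `-N`; the relation 1/Γ(s) = s/Γ(s+1) carries
its derivative from `-N` to `-(N+1)`, multiplying by the value of `s`. -/
theorem tendsto_inv_Gamma_div (N : ℕ) :
    Tendsto (fun s : ℂ => (Complex.Gamma s)⁻¹ / (s + N)) (𝓝[≠] (-(N : ℂ)))
      (𝓝 ((-1) ^ N * N !)) := by
  induction N with
  | zero =>
    have h1 : Tendsto (fun s : ℂ => (Complex.Gamma (s + 1))⁻¹) (𝓝[≠] 0) (𝓝 1) := by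
      have hc : Continuous fun s : ℂ => (Complex.Gamma (s + 1))⁻¹ :=
        Complex.differentiable_one_div_Gamma.continuous.comp (continuous_id.add continuous_const)
      have := hc.tendsto 0
      simp only [zero_add, Complex.Gamma_one, inv_one] at this
      exact this.mono_left nhdsWithin_le_nhds
    simp only [Nat.cast_zero, neg_zero, add_zero, pow_zero, Nat.factorial_zero, Nat.cast_one,
      mul_one]
    refine h1.congr' ?_
    filter_upwards [self_mem_nhdsWithin] with s hs
    have hs' : s ≠ 0 := hs
    rw [Complex.one_div_Gamma_eq_self_mul_one_div_Gamma_add_one s]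
    field_simp
  | succ N ih =>
    have hadd : Tendsto (fun s : ℂ => s + 1) (𝓝[≠] (-((N + 1 : ℕ) : ℂ))) (𝓝[≠] (-(N : ℂ))) := by
      refine tendsto_nhdsWithin_of_tendsto_nhds_of_eventually_within _ ?_ ?_
      · have : Tendsto (fun s : ℂ => s + 1) (𝓝 (-((N + 1 : ℕ) : ℂ)))
            (𝓝 (-((N + 1 : ℕ) : ℂ) + 1)) := (continuous_id.add continuous_const).tendsto _
        rw [show -((N + 1 : ℕ) : ℂ) + 1 = -(N : ℂ) by push_cast; ring] at this
        exact this.mono_left nhdsWithin_le_nhds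
      · filter_upwards [self_mem_nhdsWithin] with s hs
        intro h
        apply hs
        have h' : s + 1 = -(N : ℂ) := h
        rw [Set.mem_singleton_iff]
        push_cast
        linear_combination h'
    have hid : Tendsto (fun s : ℂ => s) (𝓝[≠] (-((N + 1 : ℕ) : ℂ))) (𝓝 (-((N + 1 : ℕ) : ℂ))) :=
      nhdsWithin_le_nhds
    have h2 := hid.mul (ih.comp hadd)
    rw [show -((N + 1 : ℕ) : ℂ) * ((-1) ^ N * N !) = (-1) ^ (N + 1) * ((N + 1)! : ℕ) by
      rw [Nat.factorial_succ]
      push_cast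
      ring] at h2
    refine h2.congr fun s => ?_
    rw [Function.comp_apply, Complex.one_div_Gamma_eq_self_mul_one_div_Gamma_add_one s]
    push_cast
    rw [show s + 1 + (N : ℂ) = s + (N + 1) by ring]
    ring

theorem inv_Gamma_neg_nat (N : ℕ) : (Complex.Gamma (-(N : ℂ)))⁻¹ = 0 := by
  rw [Complex.Gamma_neg_nat_eq_zero, inv_zero]

/-- Everything regular at `-N` is annihilated by the zero of 1/Γ; the one singular term `c j / (z +
N)` meets that zero in a finite limit. Strict monotonicity keeps the earlier fractions regular. -/
theorem HasPowerExpansion.tendsto_mellinCont {f : ℝ → ℂ} {c : ℕ → ℂ} {e : ℕ → ℝ}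
    (hf : HasPowerExpansion f c e) (he : StrictMono e) {j N : ℕ} (hj : e j = N) :
    Tendsto (fun z => mellinCont f c e (j + 1) z * (Complex.Gamma z)⁻¹) (𝓝[≠] (-(N : ℂ)))
      (𝓝 ((-1) ^ N * N ! * c j)) := by
  -- Term `j` itself must be split off: only the remainder after `j + 1` terms is holomorphic around
  -- `-N`.
  have hN : -e (j + 1) < (-(N : ℂ)).re := by
    have := he (Nat.lt_succ_self j)
    rw [hj] at this
    simp only [Complex.neg_re, Complex.natCast_re]
    exact neg_lt_neg this
  have hc1 : ContinuousAt (fun z => (mellin (cutRemainder f c e (j + 1)) z +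
      ∑ i ∈ Finset.range j, c i / (z + e i)) * (Complex.Gamma z)⁻¹) (-(N : ℂ)) := by
    refine ContinuousAt.mul (ContinuousAt.add
      (hf.analyticAt_mellin_remainder (j + 1) hN).continuousAt ?_)
      (analyticAt_inv_Gamma _).continuousAt
    refine tendsto_finsetSum _ fun i hi => ?_
    refine ContinuousAt.div continuousAt_const (by fun_prop) ?_
    have h1 := he (Finset.mem_range.1 hi)
    rw [hj] at h1
    intro h
    have h2 : ((e i : ℝ) : ℂ) = ((N : ℝ) : ℂ) := by
      push_cast
      linear_combination h
    rw [Complex.ofReal_inj] at h2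
    linarith
  have h1 := hc1.tendsto.mono_left (nhdsWithin_le_nhds (s := {(-(N : ℂ))}ᶜ))
  rw [inv_Gamma_neg_nat, mul_zero] at h1
  have h2 := h1.add ((tendsto_inv_Gamma_div N).mul_const (c j))
  rw [zero_add] at h2
  refine h2.congr fun z => ?_
  rw [mellinCont, Finset.sum_range_succ, hj]
  push_cast
  ring

/-- Two meromorphic functions that agree on a half plane agree near every point. -/
theorem eventuallyEq_nhdsNE_of_eq_halfPlane {Z W : ℂ → ℂ} (hZ : MeromorphicOn Z Set.univ)
    (hW : MeromorphicOn W Set.univ) {a : ℝ} (h : ∀ s : ℂ, a < s.re → Z s = W s) (s : ℂ) :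
    Z =ᶠ[𝓝[≠] s] W := by
  have hm : MeromorphicOn (Z - W) Set.univ := hZ.sub hW
  -- The difference has infinite order at a point of the half plane, and on a connected domain this
  -- propagates everywhere.
  have h0 : meromorphicOrderAt (Z - W) ((a + 1 : ℝ) : ℂ) = ⊤ := by
    rw [meromorphicOrderAt_eq_top_iff]
    refine Filter.Eventually.filter_mono nhdsWithin_le_nhds ?_
    have hmem : ((a + 1 : ℝ) : ℂ) ∈ {s : ℂ | a < s.re} := by simp
    filter_upwards [(isOpen_lt continuous_const Complex.continuous_re).mem_nhds hmem] with z hz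
    rw [Pi.sub_apply, h z hz, sub_self]
  have h1 : meromorphicOrderAt (Z - W) s = ⊤ := by
    by_contra hne
    exact hm.meromorphicOrderAt_ne_top_of_isPreconnected isPreconnected_univ (Set.mem_univ s)
      (Set.mem_univ _) hne h0
  filter_upwards [meromorphicOrderAt_eq_top_iff.1 h1] with z hz
  exact sub_eq_zero.1 hz

/-- A finite limit excludes a pole, and normal form excludes a removable singularity with a wrong
value. -/
theorem analyticAt_and_eq_of_tendsto {Z : ℂ → ℂ} {s v : ℂ} (hZ : MeromorphicNFAt Z s)
    (h : Tendsto Z (𝓝[≠] s) (𝓝 v)) : AnalyticAt ℂ Z s ∧ Z s = v := by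
  have h1 : AnalyticAt ℂ Z s := hZ.meromorphicOrderAt_nonneg_iff_analyticAt.1
    ((tendsto_nhds_iff_meromorphicOrderAt_nonneg hZ.meromorphicAt).1 ⟨v, h⟩)
  exact ⟨h1, tendsto_nhds_unique (h1.continuousAt.tendsto.mono_left nhdsWithin_le_nhds) h⟩

end MahlerSeries

/-! ### Polar coordinates for the sup norm. -/

namespace MahlerSeries

open Finset MeasureTheory Set Filter Topology
open scoped Nat Pointwise

/-- The points of the space whose `i`-th coordinate is maximal. -/
def maxSector {n : ℕ} (i : Fin n) : Set (Fin n → ℝ) := {x | ∀ k, x k ≤ x i}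

theorem measurableSet_maxSector {n : ℕ} (i : Fin n) : MeasurableSet (maxSector i) := by
  have : maxSector i = ⋂ k, {x : Fin n → ℝ | x k ≤ x i} := by
    ext x
    simp [maxSector]
  rw [this]
  exact MeasurableSet.iInter fun k => measurableSet_le (measurable_pi_apply k)
    (measurable_pi_apply i)

theorem iUnion_maxSector {n : ℕ} (hn : 1 ≤ n) : ⋃ i : Fin n, maxSector i = Set.univ := by
  have : Nonempty (Fin n) := ⟨⟨0, hn⟩⟩
  refine Set.eq_univ_of_forall fun x => ?_
  obtain ⟨i, hi⟩ := Finite.exists_max x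
  exact Set.mem_iUnion.2 ⟨i, hi⟩

theorem volume_eq_coord {n : ℕ} {i j : Fin n} (hij : i ≠ j) :
    volume {x : Fin n → ℝ | x i = x j} = 0 := by
  set L : Submodule ℝ (Fin n → ℝ) :=
    LinearMap.ker ((LinearMap.proj i : (Fin n → ℝ) →ₗ[ℝ] ℝ) - LinearMap.proj j)
  have hL : ({x : Fin n → ℝ | x i = x j} : Set (Fin n → ℝ)) = L := by
    ext x
    simp [L, sub_eq_zero]
  rw [hL]
  refine Measure.addHaar_submodule _ _ fun htop => ?_
  have h1 : (Pi.single i 1 : Fin n → ℝ) ∈ L := htop ▸ Submodule.mem_top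
  simp [L, Pi.single_eq_of_ne hij.symm] at h1

/-- The sectors cover the space, and two of them meet only inside a null hyperplane `x i = x j`. -/
theorem integral_eq_sum_maxSector {n : ℕ} (hn : 1 ≤ n) {f : (Fin n → ℝ) → ℝ}
    (hf : Integrable f (orthant n)) :
    ∫ x, f x ∂(orthant n) = ∑ i, ∫ x in maxSector i, f x ∂(orthant n) := by
  have h1 := hasSum_integral_iUnion_ae (μ := orthant n) (s := fun i : Fin n => maxSector i)
    (fun i => (measurableSet_maxSector i).nullMeasurableSet) (f := f) ?_ hf.integrableOn
  · rw [iUnion_maxSector hn, Measure.restrict_univ] at h1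
    exact h1.unique (hasSum_fintype _)
  · intro i j hij
    have h2 : (maxSector i ∩ maxSector j : Set (Fin n → ℝ)) ⊆ {x | x i = x j} := fun x hx =>
      le_antisymm (hx.2 i) (hx.1 j)
    refine measure_mono_null h2 ?_
    rw [orthant_eq_restrict]
    exact Measure.restrict_le_self.absolutelyContinuous (volume_eq_coord hij)

theorem insertNth_mem_maxSector {m : ℕ} {i : Fin (m + 1)} {t : ℝ} {x : Fin m → ℝ} :
    (i.insertNth t x : Fin (m + 1) → ℝ) ∈ maxSector i ↔ ∀ k, x k ≤ t := by
  rw [maxSector, Set.mem_ofPred_eq, Fin.forall_iff_succAbove i]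
  simp

theorem smul_pi_Ioc {m : ℕ} {t : ℝ} (ht : 0 < t) :
    t • (Set.univ.pi fun _ : Fin m => Set.Ioc (0 : ℝ) 1) =
      Set.univ.pi fun _ => Set.Ioc (0 : ℝ) t := by
  ext x
  rw [Set.mem_smul_set_iff_inv_smul_mem₀ ht.ne']
  simp only [Set.mem_pi, Set.mem_univ, true_implies, Pi.smul_apply, smul_eq_mul, Set.mem_Ioc]
  refine forall_congr' fun k => ?_
  rw [inv_mul_le_iff₀ ht, mul_one]
  refine and_congr_left fun _ => ?_
  exact mul_pos_iff_of_pos_left (inv_pos.2 ht)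

theorem smul_insertNth_one {m : ℕ} (i : Fin (m + 1)) (t : ℝ) (y : Fin m → ℝ) :
    t • (i.insertNth 1 y : Fin (m + 1) → ℝ) = i.insertNth t (t • y) := by
  ext k
  refine Fin.succAboveCases i ?_ (fun k => ?_) k <;> simp

/-- In the sector write x = t ŷ with `t = x i`; the other `m` coordinates range over `(0, t]`, and
scaling them to the unit cube produces `t ^ m`. -/
theorem setIntegral_orthant_maxSector {m : ℕ} (i : Fin (m + 1)) {f : (Fin (m + 1) → ℝ) → ℝ}
    (hf : Integrable f (orthant (m + 1))) :
    ∫ x in maxSector i, f x ∂(orthant (m + 1)) =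
      ∫ t in Set.Ioi 0, t ^ m * ∫ y in Set.univ.pi fun _ : Fin m => Set.Ioc (0 : ℝ) 1,
        f (t • i.insertNth 1 y) := by
  rw [← integral_indicator (measurableSet_maxSector i)]
  have hi := hf.indicator (measurableSet_maxSector i)
  have h1 := (measurePreserving_insertNth m i).integrable_comp_of_integrable hi
  rw [← (measurePreserving_insertNth m i).integral_comp']
  refine (integral_prod _ h1).trans ?_
  refine setIntegral_congr_fun measurableSet_Ioi fun t ht => ?_
  have ht' : (0 : ℝ) < t := ht
  have e1 : ∀ x : Fin m → ℝ, (maxSector i).indicator f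
      ((MeasurableEquiv.piFinSuccAbove (fun _ : Fin (m + 1) => ℝ) i).symm (t, x)) =
      {x : Fin m → ℝ | ∀ k, x k ≤ t}.indicator (fun x => f (i.insertNth t x)) x := by
    intro x
    by_cases hx : ∀ k, x k ≤ t
    · rw [Set.indicator_of_mem (show x ∈ {x : Fin m → ℝ | ∀ k, x k ≤ t} from hx)]
      exact Set.indicator_of_mem (insertNth_mem_maxSector.2 hx) f
    · rw [Set.indicator_of_notMem (show x ∉ {x : Fin m → ℝ | ∀ k, x k ≤ t} from hx)]
      exact Set.indicator_of_notMem (fun h => hx (insertNth_mem_maxSector.1 h)) f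
  have hmeas : MeasurableSet {x : Fin m → ℝ | ∀ k, x k ≤ t} := by
    have : {x : Fin m → ℝ | ∀ k, x k ≤ t} = Set.univ.pi fun _ => Set.Iic t := by
      ext x
      simp [Pi.le_def]
    rw [this]
    exact MeasurableSet.univ_pi fun _ => measurableSet_Iic
  have hset : {x : Fin m → ℝ | ∀ k, x k ≤ t} ∩ (Set.univ.pi fun _ => Set.Ioi 0) =
      t • (Set.univ.pi fun _ : Fin m => Set.Ioc (0 : ℝ) 1) := by
    rw [smul_pi_Ioc ht']
    ext x
    simp only [Set.mem_inter_iff, Set.mem_ofPred_eq, Set.mem_pi, Set.mem_univ, true_implies,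
      Set.mem_Ioi, Set.mem_Ioc]
    exact ⟨fun h k => ⟨h.2 k, h.1 k⟩, fun h => ⟨fun k => (h k).2, fun k => (h k).1⟩⟩
  refine (integral_congr_ae (Eventually.of_forall e1)).trans ?_
  rw [integral_indicator hmeas, orthant_eq_restrict,
    Measure.restrict_restrict hmeas, hset]
  have h2 := Measure.setIntegral_comp_smul_of_pos (volume : Measure (Fin m → ℝ))
    (fun x => f (i.insertNth t x)) (Set.univ.pi fun _ : Fin m => Set.Ioc (0 : ℝ) 1) ht'
  rw [Module.finrank_fin_fun, smul_eq_mul] at h2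
  simp only [smul_insertNth_one]
  rw [h2, mul_inv_cancel_left₀ (pow_pos ht' m).ne']

theorem integrableOn_pow_mul_exp {d : ℕ} (hd : 1 ≤ d) (K : ℕ) {b : ℝ} (hb : 0 < b) :
    IntegrableOn (fun t : ℝ => t ^ K * Real.exp (-b * t ^ d)) (Set.Ioi 0) := by
  have h := integrableOn_rpow_mul_exp_neg_mul_rpow (p := d) (s := K) (b := b)
    (by have : (0 : ℝ) ≤ K := Nat.cast_nonneg K
        linarith) (by exact_mod_cast hd) hb
  simpa only [Real.rpow_natCast] using h

theorem integral_pow_mul_exp {d j K : ℕ} (hd : 1 ≤ d) (hj : 1 ≤ j) (hK : K + 1 = d * j) {b : ℝ}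
    (hb : 0 < b) :
    ∫ t in Set.Ioi (0 : ℝ), t ^ K * Real.exp (-b * t ^ d) =
      ((j - 1)! : ℝ) / d * b ^ (-(j : ℤ)) := by
  have hd' : (0 : ℝ) < d := by exact_mod_cast hd
  have h := integral_rpow_mul_exp_neg_mul_rpow (p := d) (q := K) (b := b) hd'
    (by have : (0 : ℝ) ≤ K := Nat.cast_nonneg K
        linarith) hb
  have hK' : ((K : ℝ) + 1) / d = j := by
    rw [div_eq_iff hd'.ne']
    have : ((K + 1 : ℕ) : ℝ) = ((d * j : ℕ) : ℝ) := by rw [hK]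
    push_cast at this
    linarith
  simp only [Real.rpow_natCast] at h
  rw [h, neg_div, hK', Real.rpow_neg hb.le, Real.rpow_natCast, zpow_neg, zpow_natCast]
  obtain ⟨j, rfl⟩ : ∃ k, j = k + 1 := ⟨j - 1, by omega⟩
  push_cast
  rw [Real.Gamma_nat_eq_factorial]
  ring

theorem insertNth_one_mem_sphere {m : ℕ} (i : Fin (m + 1)) {y : Fin m → ℝ}
    (hy : ∀ k, y k ∈ Set.Icc (0 : ℝ) 1) :
    (∀ k, 0 ≤ (i.insertNth 1 y : Fin (m + 1) → ℝ) k) ∧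
      ‖(i.insertNth 1 y : Fin (m + 1) → ℝ)‖ = 1 := by
  have h0 : ∀ k, 0 ≤ (i.insertNth 1 y : Fin (m + 1) → ℝ) k ∧
      (i.insertNth 1 y : Fin (m + 1) → ℝ) k ≤ 1 := by
    rw [Fin.forall_iff_succAbove i]
    simpa using hy
  refine ⟨fun k => (h0 k).1, le_antisymm ?_ ?_⟩
  · refine (pi_norm_le_iff_of_nonneg zero_le_one).2 fun k => ?_
    rw [Real.norm_of_nonneg (h0 k).1]
    exact (h0 k).2
  · have := norm_le_pi_norm (i.insertNth 1 y : Fin (m + 1) → ℝ) i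
    simpa using this

/-- Homogeneity separates radius and face. The radial integral of $t^{m+D}e^{-Pt^d}$ is
$\Gamma(j)P^{-j}/d$, the degree condition making the Gamma argument the integer `j`. -/
theorem setIntegral_expPoly_maxSector {m d j D : ℕ} {P G : MvPolynomial (Fin (m + 1)) ℝ}
    (hP : IsElliptic P) (hPd : P.IsHomogeneous d) (hd : 1 ≤ d) (hG : G.IsHomogeneous D)
    (hj : 1 ≤ j) (hD : D + (m + 1) = d * j) (i : Fin (m + 1)) :
    ∫ x in maxSector i, expPoly P G x ∂(orthant (m + 1)) =
      ((j - 1)! : ℝ) / d * ∫ y in Set.univ.pi fun _ : Fin m => Set.Ioc (0 : ℝ) 1,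
        MvPolynomial.eval (i.insertNth 1 y) P ^ (-(j : ℤ)) *
          MvPolynomial.eval (i.insertNth 1 y) G := by
  obtain ⟨C, hC0, hC⟩ := hP.exists_abs_expPoly_le hPd hd G
  have hint : Integrable (expPoly P G) (orthant (m + 1)) := by
    have := integrable_expPoly_mixRound hC0 hC one_pos Finset.univ
    simpa only [mixRound_univ] using this
  rw [setIntegral_orthant_maxSector i hint]
  set S : Set (Fin m → ℝ) := Set.univ.pi fun _ => Set.Ioc (0 : ℝ) 1 with hS
  have hSm : MeasurableSet S := MeasurableSet.univ_pi fun _ => measurableSet_Ioc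
  set z : (Fin m → ℝ) → Fin (m + 1) → ℝ := fun y => i.insertNth 1 y with hz
  have hzc : Continuous z := continuous_const.finInsertNth i continuous_id
  have hzS : ∀ y ∈ S, (∀ k, 0 ≤ z y k) ∧ ‖z y‖ = 1 := fun y hy =>
    insertNth_one_mem_sphere i fun k => Set.Ioc_subset_Icc_self (hy k (Set.mem_univ k))
  have e1 : ∀ t y, t ^ m * expPoly P G (t • z y) = MvPolynomial.eval (z y) G *
      (t ^ (m + D) * Real.exp (-MvPolynomial.eval (z y) P * t ^ d)) := by
    intro t y
    rw [expPoly, eval_smul_of_isHomogeneous hG, eval_smul_of_isHomogeneous hPd, pow_add, neg_mul,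
      mul_comm (t ^ d)]
    ring
  obtain ⟨c, hc0, hc⟩ := hP.exists_le_eval hPd hd
  obtain ⟨B, hB0, hB⟩ := exists_abs_eval_le_of_isHomogeneous hG
  -- Fubini: points of the face have norm 1, so `P ≥ c` and `|G| ≤ B` there, and a function of `t`
  -- alone dominates.
  have hprod : Integrable (Function.uncurry fun (t : ℝ) (y : Fin m → ℝ) =>
      MvPolynomial.eval (z y) G * (t ^ (m + D) * Real.exp (-MvPolynomial.eval (z y) P * t ^ d)))
      ((volume.restrict (Set.Ioi 0)).prod (volume.restrict S)) := by
    have hSfin : volume S ≠ ⊤ := by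
      rw [hS, Real.volume_pi_Ioc]
      simp
    have hb : Integrable (fun p : ℝ × (Fin m → ℝ) =>
        (p.1 ^ (m + D) * Real.exp (-c * p.1 ^ d)) * B)
        ((volume.restrict (Set.Ioi 0)).prod (volume.restrict S)) :=
      Integrable.mul_prod (f := fun t : ℝ => t ^ (m + D) * Real.exp (-c * t ^ d))
        (g := fun _ : Fin m → ℝ => B) (integrableOn_pow_mul_exp hd _ hc0)
        (integrableOn_const hSfin)
    refine hb.mono' ?_ ?_
    · refine Continuous.aestronglyMeasurable ?_
      have h1 := MvPolynomial.continuous_eval G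
      have h2 := MvPolynomial.continuous_eval P
      unfold Function.uncurry
      fun_prop
    · rw [Measure.prod_restrict]
      filter_upwards [ae_restrict_mem (measurableSet_Ioi.prod hSm)] with p hp
      have ht : 0 < p.1 := hp.1
      have hy := hzS p.2 hp.2
      have h1 := hB _ hy.1 (fun h => by simp [h] at hy)
      have h2 := hc _ hy.1
      rw [hy.2, one_pow, mul_one] at h1 h2
      rw [Function.uncurry, norm_mul, Real.norm_eq_abs, Real.norm_of_nonneg (by positivity),
        mul_comm]
      refine mul_le_mul (mul_le_mul_of_nonneg_left (Real.exp_le_exp.2 ?_) (by positivity)) h1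
        (abs_nonneg _) (by positivity)
      exact mul_le_mul_of_nonneg_right (neg_le_neg h2) (by positivity)
  simp only [← integral_const_mul]
  have e2 : ∫ t in Set.Ioi 0, ∫ y in S, t ^ m * expPoly P G (t • i.insertNth 1 y) =
      ∫ t in Set.Ioi 0, ∫ y in S, MvPolynomial.eval (z y) G *
        (t ^ (m + D) * Real.exp (-MvPolynomial.eval (z y) P * t ^ d)) := by
    simp only [← e1]
    rfl
  rw [e2, integral_integral_swap hprod]
  refine setIntegral_congr_fun hSm fun y hy => ?_
  rw [integral_const_mul, integral_pow_mul_exp hd hj (by omega)]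
  · ring
  · refine hP.eval_pos hPd (hzS y hy).1 fun h => ?_
    have := (hzS y hy).2
    rw [h, norm_zero] at this
    exact zero_ne_one this

theorem hat_comp_finSuccAbove {m : ℕ} (i : Fin (m + 1)) (y : {k : Fin (m + 1) // k ≠ i} → ℝ) :
    hat i y = i.insertNth 1 fun k => y (finSuccAboveEquiv i k) := by
  ext k
  refine Fin.succAboveCases i ?_ (fun k => ?_) k
  · simp [hat]
  · simp [hat, Fin.succAbove_ne, finSuccAboveEquiv_apply]

/-- Closed and half-open cubes differ by a null set; the rest renames the coordinates other than
`i`. -/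
theorem setIntegral_hat {m : ℕ} (i : Fin (m + 1)) (f : (Fin (m + 1) → ℝ) → ℝ) :
    ∫ y in Set.Icc (0 : {k : Fin (m + 1) // k ≠ i} → ℝ) 1, f (hat i y) =
      ∫ y in Set.univ.pi fun _ : Fin m => Set.Ioc (0 : ℝ) 1, f (i.insertNth 1 y) := by
  have hae : (Set.univ.pi fun _ : Fin m => Set.Ioc (0 : ℝ) 1) =ᵐ[volume]
      Set.Icc (0 : Fin m → ℝ) 1 := Measure.univ_pi_Ioc_ae_eq_Icc
  rw [setIntegral_congr_set hae]
  have hmp := volume_measurePreserving_piCongrLeft (fun _ : {k : Fin (m + 1) // k ≠ i} => ℝ)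
    (finSuccAboveEquiv i)
  rw [← hmp.setIntegral_preimage_emb (MeasurableEquiv.measurableEmbedding _)]
  have happ : ∀ (y : Fin m → ℝ) (k : Fin m), MeasurableEquiv.piCongrLeft
      (fun _ : {k : Fin (m + 1) // k ≠ i} => ℝ) (finSuccAboveEquiv i) y (finSuccAboveEquiv i k) =
      y k := fun y k => MeasurableEquiv.piCongrLeft_apply_apply (β := fun _ => ℝ) _ y k
  have hpre : MeasurableEquiv.piCongrLeft (fun _ : {k : Fin (m + 1) // k ≠ i} => ℝ)
      (finSuccAboveEquiv i) ⁻¹' Set.Icc 0 1 = Set.Icc (0 : Fin m → ℝ) 1 := by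
    ext y
    simp only [Set.mem_preimage, Set.mem_Icc, Pi.le_def,
      (finSuccAboveEquiv i).surjective.forall, happ, Pi.zero_apply, Pi.one_apply]
  rw [hpre]
  simp only [hat_comp_finSuccAbove, happ]

end MahlerSeries

/-! ### The expansion coefficients as sums of periods, and the series as a Mellin transform. -/

namespace MahlerSeries

open Finset MeasureTheory Set Filter Topology Asymptotics
open scoped Nat

theorem integrable_expPoly {n d : ℕ} {P : MvPolynomial (Fin n) ℝ} (hP : IsElliptic P)
    (hPd : P.IsHomogeneous d) (hd : 1 ≤ d) (G : MvPolynomial (Fin n) ℝ) :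
    Integrable (expPoly P G) (orthant n) := by
  obtain ⟨C, hC0, hC⟩ := hP.exists_abs_expPoly_le hPd hd G
  simpa only [mixRound_univ] using integrable_expPoly_mixRound hC0 hC one_pos Finset.univ

theorem integral_expPoly_orthant {n d j D : ℕ} (hn : 1 ≤ n) {P G : MvPolynomial (Fin n) ℝ}
    (hP : IsElliptic P) (hPd : P.IsHomogeneous d) (hd : 1 ≤ d) (hG : G.IsHomogeneous D)
    (hj : 1 ≤ j) (hD : D + n = d * j) :
    ∫ x, expPoly P G x ∂(orthant n) = ((j - 1)! : ℝ) / d *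
      ∑ i, ∫ y in Set.Icc (0 : {k : Fin n // k ≠ i} → ℝ) 1,
        MvPolynomial.eval (hat i y) P ^ (-(j : ℤ)) * MvPolynomial.eval (hat i y) G := by
  obtain ⟨m, rfl⟩ : ∃ m, n = m + 1 := ⟨n - 1, by omega⟩
  rw [integral_eq_sum_maxSector hn (integrable_expPoly hP hPd hd G), Finset.mul_sum]
  refine Finset.sum_congr rfl fun i _ => ?_
  rw [setIntegral_expPoly_maxSector hP hPd hd hG hj hD i]
  have h := setIntegral_hat i fun x =>
    MvPolynomial.eval x P ^ (-(j : ℤ)) * MvPolynomial.eval x G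
  rw [h]

/-- The polynomial whose values are given by `Pau`. -/
noncomputable def familyPoly {n d : ℕ} (P : MvPolynomial (Fin n) ℝ) (α : Fin d → ℕ)
    (u : Family n d) : MvPolynomial (Fin n) ℝ :=
  MvPolynomial.C ((tupleFactorial α : ℝ) / (∏ k, (tupleFactorial (u k) : ℝ))) *
    ∏ k, ∏ γ, (MvPolynomial.C ((tupleFactorial γ.1 : ℝ)⁻¹) * partialDeriv γ.1 P) ^ u k γ

theorem eval_familyPoly {n d : ℕ} (P : MvPolynomial (Fin n) ℝ) (α : Fin d → ℕ) (u : Family n d)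
    (x : Fin n → ℝ) : MvPolynomial.eval x (familyPoly P α u) = Pau P α u x := by
  simp only [familyPoly, Pau, map_mul, map_prod, map_pow, MvPolynomial.eval_C, div_eq_inv_mul]

theorem isHomogeneous_familyPoly {n d : ℕ} {P : MvPolynomial (Fin n) ℝ} (hP : P.IsHomogeneous d)
    {α : Fin d → ℕ} {u : Family n d} (hu : u ∈ V n α) :
    (familyPoly P α u).IsHomogeneous (∑ k : Fin d, (d - ((k : ℕ) + 1)) * α k) := by
  rw [← zero_add (∑ k : Fin d, (d - ((k : ℕ) + 1)) * α k)]
  refine (MvPolynomial.isHomogeneous_C _ _).mul ?_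
  refine MvPolynomial.IsHomogeneous.prod _ _ _ fun k _ => ?_
  rw [← mem_V.1 hu k, Finset.mul_sum]
  refine MvPolynomial.IsHomogeneous.prod _ _ _ fun γ _ => ?_
  refine MvPolynomial.IsHomogeneous.pow ?_ _
  have h := (isHomogeneous_partialDeriv hP γ.1).1
  rw [mem_Delta.1 γ.2] at h
  have h' := (MvPolynomial.isHomogeneous_C (Fin n) ((tupleFactorial γ.1 : ℝ)⁻¹)).mul h
  rwa [zero_add] at h'

/-- Add up $d-k$ and $k$ over the factors of the product, then insert the equation defining
`indexSet`; `q - |β|` is not truncated because |β| ≤ q. -/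
theorem homogeneity_degree_add {n d q N : ℕ} {α : Fin d → ℕ} {β : Fin n → ℕ}
    (hβ : β ∈ betas n q) (hα : α ∈ indexSet d q N β) :
    (∑ k : Fin d, (d - ((k : ℕ) + 1)) * α k) + (q - ∑ i, β i) + n + d * N = d * ∑ k, α k := by
  have h1 := mem_betas.1 hβ
  have h2 := mem_indexSet.1 hα
  have h3 : ∑ k : Fin d, (d - ((k : ℕ) + 1)) * α k + ∑ k : Fin d, ((k : ℕ) + 1) * α k =
      d * ∑ k, α k := by
    rw [← Finset.sum_add_distrib, Finset.mul_sum]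
    refine Finset.sum_congr rfl fun k _ => ?_
    rw [← add_mul, Nat.sub_add_cancel k.2]
  omega

theorem lt_sum_of_mem_indexSet {n d q N : ℕ} (hn : 1 ≤ n) {α : Fin d → ℕ} {β : Fin n → ℕ}
    (hβ : β ∈ betas n q) (hα : α ∈ indexSet d q N β) : N < ∑ k, α k := by
  have h := homogeneity_degree_add hβ hα
  refine lt_of_mul_lt_mul_left (a := d) ?_ (Nat.zero_le d)
  omega

/-- The polynomial is homogeneous of degree $d(|\alpha|-N)-n$, so the radial formula applies with
$j=|\alpha|-N$. This is why the expansion is first broken up by `α`: the twisted derivatives of `Q`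
mix several degrees. -/
theorem integral_family {n d q N : ℕ} (hn : 1 ≤ n) (hd : 1 ≤ d) {P Q : MvPolynomial (Fin n) ℝ}
    (hP : IsElliptic P) (hPd : P.IsHomogeneous d) (hQ : Q.IsHomogeneous q) {α : Fin d → ℕ}
    {β : Fin n → ℕ} {u : Family n d} (hβ : β ∈ betas n q) (hα : α ∈ indexSet d q N β)
    (hu : u ∈ V n α) :
    ∫ x, expPoly P (familyPoly P α u * partialDeriv β Q) x ∂(orthant n) =
      (((∑ k, α k) - 1 - N)! : ℝ) / d * ∑ i, period P Q N α u β i := by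
  have hN := lt_sum_of_mem_indexSet hn hβ hα
  have hG := (isHomogeneous_familyPoly hPd hu).mul (isHomogeneous_partialDeriv hQ β).1
  have hD : (∑ k : Fin d, (d - ((k : ℕ) + 1)) * α k) + (q - ∑ i, β i) + n =
      d * ((∑ k, α k) - N) := by
    have h := homogeneity_degree_add hβ hα
    rw [Nat.mul_sub]
    omega
  rw [integral_expPoly_orthant hn hP hPd hd hG (by omega) hD, Nat.sub_right_comm]
  congr 1
  refine Finset.sum_congr rfl fun i _ => ?_
  rw [period]
  refine integral_congr_ae (Eventually.of_forall fun y => ?_)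
  have he : -(((∑ k, α k) - N : ℕ) : ℤ) = (N : ℤ) - ((∑ k, α k : ℕ) : ℤ) := by
    rw [Nat.cast_sub hN.le]
    ring
  simp only [map_mul, eval_familyPoly, he, mul_assoc]

theorem modBernoulli_eq (k : ℕ) : modBernoulli k = bernoulli' k := by
  rw [modBernoulli]
  split_ifs with h
  · rw [h, bernoulli'_eq_bernoulli, pow_one, neg_one_mul]
  · exact bernoulli_eq_bernoulli'_of_ne_one h

/-- The factorials dividing the Bernoulli numbers are those that normalise `twistTaylor`. -/
theorem moment_eq_integral {n d : ℕ} (hd : 1 ≤ d) {P : MvPolynomial (Fin n) ℝ}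
    (hP : IsElliptic P) (hPd : P.IsHomogeneous d) (Q : MvPolynomial (Fin n) ℝ) (j : ℕ) :
    moment P Q j = ∫ x, (∑ δ ∈ Delta n j, (∏ i, (modBernoulli (δ i) : ℝ)) *
      MvPolynomial.eval x (twistTaylor P Q δ)) * Real.exp (-MvPolynomial.eval x P)
      ∂(orthant n) := by
  have h1 : ∀ x, (∑ δ ∈ Delta n j, (∏ i, (modBernoulli (δ i) : ℝ)) *
      MvPolynomial.eval x (twistTaylor P Q δ)) * Real.exp (-MvPolynomial.eval x P) =
      ∑ δ ∈ Delta n j, (∏ i, toddCoeff (δ i)) * expPoly P (iterOp (twist P) δ Q) x := by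
    intro x
    rw [Finset.sum_mul]
    refine Finset.sum_congr rfl fun δ _ => ?_
    simp only [twistTaylor, MvPolynomial.smul_eval, modBernoulli_eq, toddCoeff,
      Finset.prod_div_distrib, expPoly, tupleFactorial, Nat.cast_prod]
    ring
  simp only [h1]
  rw [integral_finsetSum _ fun δ _ => (integrable_expPoly hP hPd hd _).const_mul _]
  simp only [integral_const_mul, moment]

theorem factorial_mul_moment {n d q : ℕ} (hn : 1 ≤ n) (hd : 1 ≤ d) {P Q : MvPolynomial (Fin n) ℝ}
    (hP : IsElliptic P) (hPd : P.IsHomogeneous d) (hQ : Q.IsHomogeneous q) (N : ℕ) :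
    (-1 : ℝ) ^ N * (N ! : ℝ) * moment P Q (d * N + q + n) =
      ∑ β ∈ betas n q, ∑ α ∈ indexSet d q N β, ∑ u ∈ V n α,
        ((-1 : ℝ) ^ ((∑ k, α k) - N) * (((∑ k, α k) - 1 - N)! : ℝ) * (N ! : ℝ)) /
          ((d : ℝ) * (tupleFactorial α : ℝ) * (tupleFactorial β : ℝ)) *
        (∑ i, period P Q N α u β i) * ∏ i, (modBernoulli (g u i + β i) : ℝ) := by
  have h1 : ∀ x, (∑ δ ∈ Delta n (d * N + q + n), (∏ i, (modBernoulli (δ i) : ℝ)) *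
      MvPolynomial.eval x (twistTaylor P Q δ)) * Real.exp (-MvPolynomial.eval x P) =
      ∑ β ∈ betas n q, ∑ α ∈ indexSet d q N β, ∑ u ∈ V n α,
        ((-1 : ℝ) ^ (∑ k, α k) / ((tupleFactorial α : ℝ) * (tupleFactorial β : ℝ)) *
          ∏ i, (modBernoulli (g u i + β i) : ℝ)) *
          expPoly P (familyPoly P α u * partialDeriv β Q) x := by
    intro x
    rw [sum_mul_eval_twistTaylor hPd hQ (fun k => (modBernoulli k : ℝ)) x]
    simp only [Finset.sum_mul, expPoly, map_mul, eval_familyPoly, mul_assoc]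
  rw [moment_eq_integral hd hP hPd]
  simp only [h1]
  have hint : ∀ (β : Fin n → ℕ) (α : Fin d → ℕ) (u : Family n d) (a : ℝ),
      Integrable (fun x => a * expPoly P (familyPoly P α u * partialDeriv β Q) x) (orthant n) :=
    fun β α u a => (integrable_expPoly hP hPd hd _).const_mul a
  rw [integral_finsetSum _ fun β _ => integrable_finsetSum _ fun α _ =>
    integrable_finsetSum _ fun u _ => hint β α u _, Finset.mul_sum]
  refine Finset.sum_congr rfl fun β hβ => ?_
  rw [integral_finsetSum _ fun α _ => integrable_finsetSum _ fun u _ => hint β α u _,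
    Finset.mul_sum]
  refine Finset.sum_congr rfl fun α hα => ?_
  rw [integral_finsetSum _ fun u _ => hint β α u _, Finset.mul_sum]
  refine Finset.sum_congr rfl fun u hu => ?_
  rw [integral_const_mul, integral_family hn hd hP hPd hQ hβ hα hu]
  -- The signs from the residue of Γ and from exp(-P) combine, since |α| + N and |α| - N have equal
  -- parity and N < |α|.
  have hsign : (-1 : ℝ) ^ N * (-1) ^ (∑ k, α k) = (-1) ^ ((∑ k, α k) - N) := by
    obtain ⟨c, hc⟩ := Nat.exists_eq_add_of_le (lt_sum_of_mem_indexSet hn hβ hα).le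
    rw [hc, Nat.add_sub_cancel_left, pow_add, ← mul_assoc, ← mul_pow]
    simp
  rw [← hsign]
  simp only [div_eq_mul_inv, mul_inv]
  ring

theorem strictMono_thetaExponent (n q : ℕ) {d : ℕ} (hd : 1 ≤ d) :
    StrictMono (thetaExponent n d q) := by
  intro a b hab
  have hd' : (0 : ℝ) < d := by exact_mod_cast hd
  have : (a : ℝ) < b := by exact_mod_cast hab
  exact div_lt_div_of_pos_right (by linarith) hd'

theorem tendsto_thetaExponent (n q : ℕ) {d : ℕ} (hd : 1 ≤ d) :
    Tendsto (thetaExponent n d q) atTop atTop := by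
  have hd' : (0 : ℝ) < d := by exact_mod_cast hd
  refine Tendsto.atTop_div_const hd' ?_
  simp only [sub_eq_add_neg]
  exact tendsto_atTop_add_const_right _ _ (tendsto_atTop_add_const_right _ _
    tendsto_natCast_atTop_atTop)

theorem thetaExponent_zero (n d q : ℕ) : thetaExponent n d q 0 = -(((n : ℝ) + q) / d) := by
  rw [thetaExponent, Nat.cast_zero]
  ring

theorem thetaExponent_eq_natCast (n q N : ℕ) {d : ℕ} (hd : 1 ≤ d) :
    thetaExponent n d q (d * N + q + n) = N := by
  have hd' : (d : ℝ) ≠ 0 := by exact_mod_cast (show d ≠ 0 by omega)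
  rw [thetaExponent, div_eq_iff hd']
  push_cast
  ring

theorem hasPowerExpansion_theta {n d q : ℕ} (hn : 1 ≤ n) (hd : 1 ≤ d)
    {P Q : MvPolynomial (Fin n) ℝ} (hP : IsElliptic P) (hPd : P.IsHomogeneous d)
    (hQ : Q.IsHomogeneous q) :
    HasPowerExpansion (fun t => ((theta P Q t : ℝ) : ℂ)) (fun j => ((moment P Q j : ℝ) : ℂ))
      (thetaExponent n d q) where
  locallyIntegrableOn := by
    refine ContinuousOn.locallyIntegrableOn ?_ measurableSet_Ioi
    exact Complex.continuous_ofReal.comp_continuousOn (continuousOn_theta hn hd hP hPd hQ)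
  isBigO_top a := by
    obtain ⟨c, hc0, hc⟩ := theta_isBigO_exp hn hd hP hPd hQ
    have h := hc.trans (isLittleO_exp_neg_mul_rpow_atTop hc0 (-a)).isBigO
    exact Complex.isBigO_ofReal_left.2 h
  isBigO_zero J := by
    have h := Complex.isBigO_ofReal_left.2 (theta_sub_isBigO hd hP hPd hQ J)
    simpa using h
  monotone := (strictMono_thetaExponent n q hd).monotone
  tendsto := tendsto_thetaExponent n q hd

/-- Termwise Mellin transform: each exponential contributes $\Gamma(s)P(m)^{-s}$, and absolute
convergence of the Dirichlet series justifies the exchange. -/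
theorem hasSum_term {n d q : ℕ} (hn : 1 ≤ n) (hd : 1 ≤ d)
    {P Q : MvPolynomial (Fin n) ℝ} (hP : IsElliptic P) (hPd : P.IsHomogeneous d)
    (hQ : Q.IsHomogeneous q) {s : ℂ} (hs : ((n : ℝ) + q) / d < s.re) :
    HasSum (term P Q s)
      (mellin (fun t => ((theta P Q t : ℝ) : ℂ)) s * (Complex.Gamma s)⁻¹) := by
  have hs0 : 0 < s.re := lt_of_le_of_lt (by positivity) hs
  have hpos : ∀ m : Fin n → ℕ+, 0 < MvPolynomial.eval (natPoint m) P := fun m =>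
    hP.eval_pos hPd (natPoint_nonneg m) (natPoint_ne_zero hn m)
  have h := hasSum_mellin (a := fun m : Fin n → ℕ+ => ((MvPolynomial.eval (natPoint m) Q : ℝ) : ℂ))
    (p := fun m => MvPolynomial.eval (natPoint m) P)
    (F := fun t => ((theta P Q t : ℝ) : ℂ)) (s := s) (fun m => Or.inr (hpos m)) hs0 ?_ ?_
  · refine (h.mul_right (Complex.Gamma s)⁻¹).congr_fun fun m => ?_
    have hG : Complex.Gamma s ≠ 0 := Complex.Gamma_ne_zero_of_re_pos hs0
    rw [mul_div_assoc, mul_comm, inv_mul_cancel_left₀ hG]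
    rfl
  · intro t ht
    have h1 := Complex.hasSum_ofReal.2 (hasSum_theta hd hP hPd hQ ht)
    exact h1.congr_fun fun m => by push_cast; rfl
  · simpa using summable_abs_eval_div_rpow hn hd hP hPd hQ hs

end MahlerSeries

/-! ### Proof of the value formula. -/

theorem theorem4 (n d q : ℕ) (hn : 1 ≤ n) (hd : 1 ≤ d)
    (P Q : MvPolynomial (Fin n) ℝ)
    (hP : MahlerSeries.IsElliptic P) (hPd : P.IsHomogeneous d) (hQ : Q.IsHomogeneous q) :
    (∃ Z : ℂ → ℂ, MahlerSeries.IsContinuation P Q d q Z) ∧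
    ∀ Z : ℂ → ℂ, MahlerSeries.IsContinuation P Q d q Z →
      ∀ N : ℕ,
        AnalyticAt ℂ Z (-(N : ℂ)) ∧
        Z (-(N : ℂ)) =
          ((∑ β ∈ MahlerSeries.betas n q, ∑ α ∈ MahlerSeries.indexSet d q N β,
            ∑ u ∈ MahlerSeries.V n α,
              ((-1 : ℝ) ^ ((∑ k, α k) - N) * (((∑ k, α k) - 1 - N).factorial : ℝ) *
                  (N.factorial : ℝ)) /
                ((d : ℝ) * (MahlerSeries.tupleFactorial α : ℝ) *
                  (MahlerSeries.tupleFactorial β : ℝ)) *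
              (∑ i, MahlerSeries.period P Q N α u β i) *
              ∏ i, (MahlerSeries.modBernoulli (MahlerSeries.g u i + β i) : ℝ) : ℝ) : ℂ) := by
  have hf := MahlerSeries.hasPowerExpansion_theta hn hd hP hPd hQ
  obtain ⟨W, hW, hW1, hW2⟩ := hf.exists_continuation
  rw [MahlerSeries.thetaExponent_zero, neg_neg] at hW1
  have hWc : MahlerSeries.IsContinuation P Q d q W :=
    ⟨fun s hs => hW1 s hs ▸ MahlerSeries.hasSum_term hn hd hP hPd hQ hs, hW⟩
  refine ⟨⟨W, hWc⟩, fun Z hZ N => ?_⟩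
  have hmono := MahlerSeries.strictMono_thetaExponent n q hd
  have hN := MahlerSeries.thetaExponent_eq_natCast n q N hd
  have hlim := hf.tendsto_mellinCont hmono hN
  have hre : -MahlerSeries.thetaExponent n d q (d * N + q + n + 1) < (-(N : ℂ)).re := by
    have := hmono (Nat.lt_succ_self (d * N + q + n))
    rw [hN] at this
    simpa using this
  -- Any continuation coincides with the constructed one on a punctured neighbourhood, hence has the
  -- same limit at `-N`; normal form then fixes its value there.
  have hZW : Z =ᶠ[nhdsWithin (-(N : ℂ)) {-(N : ℂ)}ᶜ] W :=
    MahlerSeries.eventuallyEq_nhdsNE_of_eq_halfPlane hZ.meromorphic.meromorphicOn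
      hW.meromorphicOn (fun s hs => (hZ.hasSum s hs).unique (hWc.hasSum s hs)) _
  have h := MahlerSeries.analyticAt_and_eq_of_tendsto (hZ.meromorphic (Set.mem_univ (-(N : ℂ))))
    (hlim.congr' (hZW.trans (hW2 _ _ hre)).symm)
  refine ⟨h.1, h.2.trans ?_⟩
  rw [← MahlerSeries.factorial_mul_moment hn hd hP hPd hQ N]
  push_cast
  ring
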